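/- Let $B=\{x\in\mathbb{R}^2:|x|<1\}$ be the open unit disc, let $\hat x=x/|x|$ for $x\neq0$, and write $(\nabla v)_{ij}=\partial_j v_i$ for the weak gradient of $v\in W^{1,2}(B,\mathbb{R}^2)$. For $\varepsilon\ge 1$ let $$\mathbb{D}_\varepsilon(v)=\int_B \Big(\frac1\varepsilon\,|\nabla v(x)^T\hat x|^2+\varepsilon\,|(\operatorname{adj}\nabla v(x))\,\hat x|^2\Big)\,dx,\qquad v\in W^{1,2}(B,\mathbb{R}^2),$$ where $\operatorname{adj}$ is the adjugate matrix and $|\cdot|$ the Euclidean norm. Let $$\mathcal{A}^c=\{v\in W^{1,2}(B,\mathbb{R}^2): \det\nabla v=1 \text{ a.e. in } B,\ v=\mathrm{Id}\text{ on }\partial B \text{ in the trace sense}\},$$ where the boundary condition means $v-\mathrm{Id}\in W^{1,2}_0(B,\mathbb{R}^2)$, the closure of $C_c^\infty(B,\mathbb{R}^2)$ in $W^{1,2}(B,\mathbb{R}^2)$. **Theorem.** If $1<\varepsilon<\sqrt2$, then the identity is a global minimizer of $\mathbb{D}_\varepsilon$ in the class $\mathcal{A}^c$, and it is the only one: every global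 minimizer of $\mathbb{D}_\varepsilon$ in $\mathcal{A}^c$ equals $\mathrm{Id}$ a.e. in $B$. If $\varepsilon=\sqrt2$, then the identity is a global minimizer of $\mathbb{D}_{\sqrt2}$ in $\mathcal{A}^c$ (not necessarily the only one). -/

import Mathlib

open MeasureTheory Filter Topology
open scoped ContDiff ENNReal

namespace Buckling

/-- The Euclidean plane. -/
abbrev Plane : Type := EuclideanSpace ℝ (Fin 2)

/-- The open unit disc `B`. -/
abbrev disc : Set Plane := Metric.ball 0 1

/-- Lebesgue measure on the unit disc. -/
noncomputable abbrev discMeasure : Measure Plane := volume.restrict disc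

/-- `φ` is a smooth function with compact support contained in the open unit disc. -/
structure IsTestFunction {F : Type*} [NormedAddCommGroup F] [NormedSpace ℝ F]
    (φ : Plane → F) : Prop where
  contDiff : ContDiff ℝ ∞ φ
  hasCompactSupport : HasCompactSupport φ
  tsupport_subset : tsupport φ ⊆ disc

/-- The classical partial derivative `∂_j φ`. -/
noncomputable def partialDeriv {F : Type*} [NormedAddCommGroup F] [NormedSpace ℝ F]
    (j : Fin 2) (φ : Plane → F) (x : Plane) : F :=
  fderiv ℝ φ x (EuclideanSpace.single j 1)

/-- `G` is a square-integrable weak gradient of `v` on the disc, `G_{ij} = ∂_j v_i`. -/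
structure HasWeakGradient (v : Plane → Plane) (G : Plane → Matrix (Fin 2) (Fin 2) ℝ) :
    Prop where
  memLp : ∀ i j, MemLp (fun x => G x i j) 2 discMeasure
  integral_eq : ∀ i j, ∀ φ : Plane → ℝ, IsTestFunction φ →
    ∫ x in disc, v x i * partialDeriv j φ x = - ∫ x in disc, G x i j * φ x

/-- `v` belongs to the Sobolev space `W^{1,2}(B, ℝ²)`. -/
def MemW12 (v : Plane → Plane) : Prop :=
  MemLp v 2 discMeasure ∧ ∃ G, HasWeakGradient v G

open Classical in
/-- The weak gradient `∇v` of `v ∈ W^{1,2}(B, ℝ²)`, which is determined up to null sets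
(and `0` outside `W^{1,2}`). -/
noncomputable def weakGradient (v : Plane → Plane) : Plane → Matrix (Fin 2) (Fin 2) ℝ :=
  if h : ∃ G, HasWeakGradient v G then h.choose else 0

theorem MemW12.hasWeakGradient {v : Plane → Plane} (hv : MemW12 v) :
    HasWeakGradient v (weakGradient v) := by
  unfold weakGradient
  rw [dif_pos hv.2]
  exact hv.2.choose_spec

/-- Weak gradients are unique up to null sets. -/
theorem HasWeakGradient.ae_eq {v : Plane → Plane} {G H : Plane → Matrix (Fin 2) (Fin 2) ℝ}
    (hG : HasWeakGradient v G) (hH : HasWeakGradient v H) : G =ᵐ[discMeasure] H := by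
  have : IsFiniteMeasure discMeasure :=
    ⟨by simp [discMeasure]⟩
  have key : ∀ i j, ∀ᵐ x ∂discMeasure, G x i j = H x i j := by
    intro i j
    have hGi : IntegrableOn (fun x => G x i j) disc := (hG.memLp i j).integrable (by norm_num)
    have hHi : IntegrableOn (fun x => H x i j) disc := (hH.memLp i j).integrable (by norm_num)
    have h0 : ∀ᵐ x ∂(volume : Measure Plane), x ∈ disc → G x i j - H x i j = 0 := by
      refine Metric.isOpen_ball.ae_eq_zero_of_integral_contDiff_smul_eq_zero
        (f := fun x => G x i j - H x i j) (hGi.sub hHi).locallyIntegrableOn ?_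
      intro φ hφ hc hs
      have e := (hG.integral_eq i j φ ⟨hφ, hc, hs⟩).symm.trans
        (hH.integral_eq i j φ ⟨hφ, hc, hs⟩)
      obtain ⟨C, hC⟩ := hc.exists_bound_of_continuous hφ.continuous
      have hm : AEStronglyMeasurable φ discMeasure := hφ.continuous.aestronglyMeasurable
      have i1 : Integrable (fun x => G x i j * φ x) discMeasure :=
        Integrable.mul_bdd (c := C) hGi hm (ae_of_all _ hC)
      have i2 : Integrable (fun x => H x i j * φ x) discMeasure :=
        Integrable.mul_bdd (c := C) hHi hm (ae_of_all _ hC)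
      have hz : ∫ x in disc, φ x • (G x i j - H x i j) = 0 := by
        have : (fun x => φ x • (G x i j - H x i j))
            = fun x => G x i j * φ x - H x i j * φ x := by
          ext x; simp only [smul_eq_mul]; ring
        rw [this, integral_sub i1 i2, sub_eq_zero]
        exact neg_injective e
      rw [← hz]
      refine (setIntegral_eq_integral_of_forall_compl_eq_zero ?_).symm
      intro x hx
      rw [image_eq_zero_of_notMem_tsupport (fun h => hx (hs h)), zero_smul]
    rw [ae_restrict_iff' measurableSet_ball]
    filter_upwards [h0] with x hx hxd
    exact sub_eq_zero.mp (hx hxd)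
  have := ae_all_iff.2 fun i => ae_all_iff.2 (key i)
  filter_upwards [this] with x hx
  ext i j
  exact hx i j

/-- `u` belongs to `W_0^{1,2}(B, ℝ²)`, the closure of `C_c^∞(B, ℝ²)` in `W^{1,2}(B, ℝ²)`. -/
def MemW120 (u : Plane → Plane) : Prop :=
  MemW12 u ∧ ∃ ψ : ℕ → Plane → Plane, (∀ n, IsTestFunction (ψ n)) ∧
    Tendsto (fun n => eLpNorm (ψ n - u) 2 discMeasure) atTop (𝓝 0) ∧
    ∀ i j, Tendsto (fun n => eLpNorm
      (fun x => partialDeriv j (ψ n) x i - weakGradient u x i j) 2 discMeasure) atTop (𝓝 0)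

/-- The maps in `W^{1,2}(B, ℝ²)` that equal the identity on `∂B` in the trace sense, that is,
`v - Id ∈ W_0^{1,2}(B, ℝ²)`. -/
def identityBoundary : Set (Plane → Plane) :=
  {v | MemW12 v ∧ MemW120 (v - id)}

/-- The maps in `W^{1,2}(B, ℝ²)` with `det ∇v = 1` almost everywhere. -/
def measurePreservingMaps : Set (Plane → Plane) :=
  {v | MemW12 v ∧ ∀ᵐ x ∂discMeasure, (weakGradient v x).det = 1}

/-- The incompressible maps with identity boundary values. -/
def admissible : Set (Plane → Plane) := measurePreservingMaps ∩ identityBoundary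

/-- The unit vector `x / |x|` (and `0` at the origin). -/
noncomputable def radial (x : Plane) : Plane := ‖x‖⁻¹ • x

/-- The integrand `ε⁻¹ |ξᵀ x̂|² + ε |(adj ξ) x̂|²`, with Euclidean norms. -/
noncomputable def integrand (ε : ℝ) (x : Plane) (ξ : Matrix (Fin 2) (Fin 2) ℝ) : ℝ :=
  ε⁻¹ * ‖Matrix.toEuclideanLin ξ.transpose (radial x)‖ ^ 2
    + ε * ‖Matrix.toEuclideanLin ξ.adjugate (radial x)‖ ^ 2

/-- The energy `𝔻_ε(v)`. -/
noncomputable def energy (ε : ℝ) (v : Plane → Plane) : ℝ :=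
  ∫ x in disc, integrand ε x (weakGradient v x)

/-- `u` is a global minimizer of `𝔻_ε` among the admissible maps. -/
def IsGlobalMinimizer (ε : ℝ) (u : Plane → Plane) : Prop :=
  u ∈ admissible ∧ ∀ v ∈ admissible, energy ε u ≤ energy ε v

end Buckling

/- Write `H = ∇v - 1`. Expanding the integrand at the identity,
`f_ε(x, 1 + H) = f_ε(x, 1) + f_ε(x, H) + 2 ε tr H - 2 (ε - ε⁻¹) x̂ · H x̂`, where
`min ε ε⁻¹ |H|² ≤ f_ε(x, H)` and `∫ tr H = 0`. Everything thus hinges on the estimate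
`|∫ x̂ · H x̂| ≤ ½ ∫ |H|²`. Since `div (x̂ ⊗ x̂) = ∇ log |x|`, integrating by parts twice turns the
left side into `∫ log |x| tr H`, and `det ∇v = 1` means `tr H = -det H`. The determinant is a null
Lagrangian, so that `∫ log |x| det H` is an integral over circles of `|x|⁻²` times the area
enclosed by the image of `v - id`, which Wirtinger's inequality (the isoperimetric inequality)
bounds by `½ ∫ |H|²`. The singularity at the origin is avoided by replacing `|x|²` with
`|x|² + δ²` and `x̂ ⊗ x̂` with `(x ⊗ x + δ² 1) / (|x|² + δ²)`, whose divergence is still exactly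
`½ ∇ log (|x|² + δ²)`. The excess energy of `v` is therefore at least
`min (2 ε - ε⁻¹) (2 ε⁻¹ - ε) ∫ |H|²`, which has the right sign when `1/√2 ≤ ε ≤ √2`. -/

namespace Buckling

open Real (pi_pos two_pi_pos)
open scoped Real

theorem memLp_restrict_of_continuousOn_isCompact {X E : Type*} [TopologicalSpace X]
    [TopologicalSpace.PseudoMetrizableSpace X] [MeasurableSpace X] [BorelSpace X]
    [NormedAddCommGroup E] {μ : Measure X} [IsFiniteMeasureOnCompacts μ] {p : ℝ≥0∞} {f : X → E}
    {s K : Set X} (hK : IsCompact K) (hKm : MeasurableSet K) (hf : ContinuousOn f K) (hsK : s ⊆ K) :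
    MemLp f p (μ.restrict s) := by
  have : IsFiniteMeasure (μ.restrict K) := ⟨by simpa using hK.measure_lt_top⟩
  obtain ⟨C, hC⟩ := hK.exists_bound_of_continuousOn hf
  exact (MemLp.of_bound (hf.aestronglyMeasurable_of_isCompact hK hKm) C
    (ae_restrict_of_forall_mem hKm hC)).mono_measure (Measure.restrict_mono hsK le_rfl)

section Wirtinger

variable {a b : ℝ}

theorem norm_fourierCoeffOn_le_of_hasDerivAt (hab : a < b) {f f' : ℝ → ℂ}
    (hf : ∀ t ∈ Set.uIcc a b, HasDerivAt f (f' t) t) (hf' : IntervalIntegrable f' volume a b)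
    (hper : f a = f b) {n : ℤ} (hn : n ≠ 0) :
    ‖fourierCoeffOn hab f n‖ ≤ (b - a) / (2 * π) * ‖fourierCoeffOn hab f' n‖ := by
  have hn1 : (1 : ℝ) ≤ |(n : ℝ)| := by exact_mod_cast Int.one_le_abs hn
  have hlen : ‖(b : ℂ) - a‖ = b - a := by
    rw [← Complex.ofReal_sub, Complex.norm_real, Real.norm_of_nonneg (sub_pos.2 hab).le]
  have hcoeff : ‖fourierCoeffOn hab f n‖ =
      (b - a) / (2 * π * |(n : ℝ)|) * ‖fourierCoeffOn hab f' n‖ := by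
    rw [fourierCoeffOn_of_hasDerivAt hab hn hf hf', hper, sub_self, mul_zero, zero_sub, norm_mul,
      norm_neg, norm_mul, hlen]
    simp only [one_div, neg_mul, inv_neg, norm_neg, norm_inv, norm_mul, Complex.norm_ofNat,
      Complex.norm_real, Real.norm_eq_abs, abs_of_pos pi_pos, Complex.norm_I, mul_one,
      Complex.norm_intCast]
    ring
  rw [hcoeff]
  exact mul_le_mul_of_nonneg_right (div_le_div_of_nonneg_left (sub_pos.2 hab).le two_pi_pos
    (le_mul_of_one_le_right two_pi_pos.le hn1)) (norm_nonneg _)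

theorem wirtinger_inequality (hab : a < b) {f f' : ℝ → ℂ}
    (hf : ∀ t ∈ Set.uIcc a b, HasDerivAt f (f' t) t) (hf' : ContinuousOn f' (Set.uIcc a b))
    (hper : f a = f b) (hmean : ∫ t in a..b, f t = 0) :
    ∫ t in a..b, ‖f t‖ ^ 2 ≤ ((b - a) / (2 * π)) ^ 2 * ∫ t in a..b, ‖f' t‖ ^ 2 := by
  have memLp_of_continuousOn {g : ℝ → ℂ} (hg : ContinuousOn g (Set.uIcc a b)) :
      MemLp g 2 (volume.restrict (Set.Ioc a b)) := by
    rw [Set.uIcc_of_le hab.le] at hg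
    exact memLp_restrict_of_continuousOn_isCompact isCompact_Icc measurableSet_Icc hg
      Set.Ioc_subset_Icc_self
  have parseval := hasSum_sq_fourierCoeffOn hab
    (memLp_of_continuousOn fun t ht => (hf t ht).continuousAt.continuousWithinAt)
  have parseval' := (hasSum_sq_fourierCoeffOn hab (memLp_of_continuousOn hf')).mul_left
    (((b - a) / (2 * π)) ^ 2)
  have hcoeff (n : ℤ) : ‖fourierCoeffOn hab f n‖ ^ 2 ≤
      ((b - a) / (2 * π)) ^ 2 * ‖fourierCoeffOn hab f' n‖ ^ 2 := by
    rcases eq_or_ne n 0 with rfl | hn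
    · have hzero : fourierCoeffOn hab f 0 = 0 := by
        simp [fourierCoeffOn_eq_integral, hmean]
      rw [hzero, norm_zero, zero_pow two_ne_zero]
      positivity
    · rw [← mul_pow]
      gcongr
      exact norm_fourierCoeffOn_le_of_hasDerivAt hab hf hf'.intervalIntegrable hper hn
  have hle := hasSum_le hcoeff parseval parseval'
  rw [smul_eq_mul, smul_eq_mul, mul_left_comm] at hle
  exact le_of_mul_le_mul_left hle (inv_pos.2 (sub_pos.2 hab))

theorem integral_sub_mean_sq_le (hab : a < b) {f f' : ℝ → ℝ}
    (hf : ∀ t ∈ Set.uIcc a b, HasDerivAt f (f' t) t) (hf' : ContinuousOn f' (Set.uIcc a b))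
    (hper : f a = f b) :
    ∫ t in a..b, (f t - (b - a)⁻¹ * ∫ s in a..b, f s) ^ 2 ≤
      ((b - a) / (2 * π)) ^ 2 * ∫ t in a..b, f' t ^ 2 := by
  set m : ℝ := (b - a)⁻¹ * ∫ s in a..b, f s with hm
  have hfint : IntervalIntegrable f volume a b := ContinuousOn.intervalIntegrable fun t ht =>
    (hf t ht).continuousAt.continuousWithinAt
  have hmean : ∫ t in a..b, (f t - m) = 0 := by
    rw [intervalIntegral.integral_sub hfint (by simp), intervalIntegral.integral_const,
      smul_eq_mul, hm, mul_inv_cancel_left₀ (sub_pos.2 hab).ne', sub_self]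
  have hcomplex := wirtinger_inequality hab (f := fun t => ((f t - m : ℝ) : ℂ))
    (f' := fun t => (f' t : ℂ)) (fun t ht => ((hf t ht).sub_const m).ofReal_comp)
    (Complex.continuous_ofReal.comp_continuousOn hf') (by rw [hper])
    (by rw [intervalIntegral.integral_ofReal, hmean, Complex.ofReal_zero])
  simpa only [Complex.norm_real, Real.norm_eq_abs, sq_abs] using hcomplex

/- This is the isoperimetric inequality for the closed curve `(f, g)`. With `m` the mean of `f`
and `κ = (b - a) / (2π)`, use `2 (f - m) g' ≤ κ⁻¹ (f - m)² + κ g'²` and `∫ g' = 0`. -/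
theorem two_mul_integral_mul_deriv_le (hab : a < b) {f f' g g' : ℝ → ℝ}
    (hf : ∀ t ∈ Set.uIcc a b, HasDerivAt f (f' t) t) (hf' : ContinuousOn f' (Set.uIcc a b))
    (hfper : f a = f b) (hg : ∀ t ∈ Set.uIcc a b, HasDerivAt g (g' t) t)
    (hg' : ContinuousOn g' (Set.uIcc a b)) (hgper : g a = g b) :
    2 * ∫ t in a..b, f t * g' t ≤
      (b - a) / (2 * π) * ∫ t in a..b, (f' t ^ 2 + g' t ^ 2) := by
  have hWirtinger := integral_sub_mean_sq_le hab hf hf' hfper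
  have hκ : 0 < (b - a) / (2 * π) := div_pos (sub_pos.2 hab) two_pi_pos
  set κ : ℝ := (b - a) / (2 * π)
  set m : ℝ := (b - a)⁻¹ * ∫ s in a..b, f s
  have hfc : ContinuousOn f (Set.uIcc a b) := fun t ht =>
    (hf t ht).continuousAt.continuousWithinAt
  have hg'_mean : ∫ t in a..b, g' t = 0 := by
    rw [intervalIntegral.integral_eq_sub_of_hasDerivAt hg hg'.intervalIntegrable, hgper, sub_self]
  have hYoung (t : ℝ) : 2 * (f t * g' t) ≤
      κ⁻¹ * (f t - m) ^ 2 + κ * g' t ^ 2 + 2 * m * g' t := by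
    have hsq : κ⁻¹ * (f t - m - κ * g' t) ^ 2 =
        κ⁻¹ * (f t - m) ^ 2 + κ * g' t ^ 2 + 2 * m * g' t - 2 * (f t * g' t) := by
      field_simp
      ring
    linarith [mul_nonneg (inv_pos.2 hκ).le (sq_nonneg (f t - m - κ * g' t))]
  calc 2 * ∫ t in a..b, f t * g' t
    _ = ∫ t in a..b, 2 * (f t * g' t) := (intervalIntegral.integral_const_mul _ _).symm
    _ ≤ ∫ t in a..b, (κ⁻¹ * (f t - m) ^ 2 + κ * g' t ^ 2 + 2 * m * g' t) :=
      intervalIntegral.integral_mono_on hab.le (ContinuousOn.intervalIntegrable (by fun_prop))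
        (ContinuousOn.intervalIntegrable (by fun_prop)) fun t _ => hYoung t
    _ = κ⁻¹ * (∫ t in a..b, (f t - m) ^ 2) + κ * ∫ t in a..b, g' t ^ 2 := by
      rw [intervalIntegral.integral_add, intervalIntegral.integral_add]
      · simp only [intervalIntegral.integral_const_mul, hg'_mean, mul_zero, add_zero]
      all_goals exact ContinuousOn.intervalIntegrable (by fun_prop)
    _ ≤ κ⁻¹ * (κ ^ 2 * ∫ t in a..b, f' t ^ 2) + κ * ∫ t in a..b, g' t ^ 2 := by gcongr
    _ = κ * ∫ t in a..b, (f' t ^ 2 + g' t ^ 2) := by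
      rw [intervalIntegral.integral_add]
      · field_simp
      all_goals exact ContinuousOn.intervalIntegrable (by fun_prop)

end Wirtinger

theorem integrableOn_ball_of_continuous {X E : Type*} [MetricSpace X] [ProperSpace X]
    [MeasurableSpace X] [OpensMeasurableSpace X] [NormedAddCommGroup E] {μ : Measure X}
    [IsFiniteMeasureOnCompacts μ] {F : X → E} (hF : Continuous F) (x : X) (r : ℝ) :
    IntegrableOn F (Metric.ball x r) μ :=
  (hF.continuousOn.integrableOn_compact (isCompact_closedBall x r)).mono_set
    Metric.ball_subset_closedBall

section Rotation

variable {V : Type*} [NormedAddCommGroup V] [InnerProductSpace ℝ V]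
  [Fact (Module.finrank ℝ V = 2)] (o : Orientation ℝ V (Fin 2))

theorem continuous_rotation_apply {Y : Type*} [TopologicalSpace Y] {θ : Y → ℝ} {u : Y → V}
    (hθ : Continuous θ) (hu : Continuous u) : Continuous fun y => o.rotation (θ y) (u y) := by
  simp only [Orientation.rotation_apply, Real.Angle.cos_coe, Real.Angle.sin_coe]
  fun_prop

theorem hasDerivAt_rotation (x : V) (t : ℝ) :
    HasDerivAt (fun s : ℝ => o.rotation s x) (o.rightAngleRotation (o.rotation t x)) t := by
  simp only [Orientation.rotation_apply, Real.Angle.cos_coe, Real.Angle.sin_coe]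
  refine (((Real.hasDerivAt_cos t).smul_const x).add
    ((Real.hasDerivAt_sin t).smul_const (o.rightAngleRotation x))).congr_deriv ?_
  simp only [map_add, map_smul, Orientation.rightAngleRotation_rightAngleRotation, smul_neg,
    neg_smul]
  abel

theorem rotation_two_pi (x : V) : o.rotation ((2 * π : ℝ) : Real.Angle) x = x := by
  rw [Real.Angle.coe_two_pi, Orientation.rotation_zero, LinearIsometryEquiv.coe_refl, id]

/-- The angular derivative `∂_θ f`, that is, the derivative of `f` along the vector field
obtained by turning the position vector through a right angle. -/
noncomputable def angularDeriv (f : V → ℝ) (x : V) : ℝ :=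
  fderiv ℝ f x (o.rightAngleRotation x)

theorem continuous_angularDeriv {f : V → ℝ} (hf : ContDiff ℝ 1 f) :
    Continuous (angularDeriv o f) :=
  (hf.continuous_fderiv one_ne_zero).clm_apply o.rightAngleRotation.continuous

theorem hasDerivAt_comp_rotation {f : V → ℝ} (hf : Differentiable ℝ f) (x : V) (t : ℝ) :
    HasDerivAt (fun s : ℝ => f (o.rotation s x)) (angularDeriv o f (o.rotation t x)) t :=
  (hf (o.rotation t x)).hasFDerivAt.comp_hasDerivAt t (hasDerivAt_rotation o x t)

theorem sq_angularDeriv_le (f : V → ℝ) (x : V) :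
    angularDeriv o f x ^ 2 ≤ ‖x‖ ^ 2 * ‖fderiv ℝ f x‖ ^ 2 := by
  rw [← mul_pow, mul_comm, sq_le_sq, abs_of_nonneg (a := _ * ‖x‖) (by positivity)]
  simpa only [angularDeriv, Real.norm_eq_abs, LinearIsometryEquiv.norm_map] using
    (fderiv ℝ f x).le_opNorm (o.rightAngleRotation x)

theorem two_mul_integral_mul_angularDeriv_comp_rotation_le {f g : V → ℝ} (hf : ContDiff ℝ 1 f)
    (hg : ContDiff ℝ 1 g) (x : V) :
    2 * ∫ t in (0 : ℝ)..2 * π, f (o.rotation t x) * angularDeriv o g (o.rotation t x) ≤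
      ∫ t in (0 : ℝ)..2 * π,
        (angularDeriv o f (o.rotation t x) ^ 2 + angularDeriv o g (o.rotation t x) ^ 2) := by
  have hrot : Continuous fun t : ℝ => o.rotation t x :=
    continuous_rotation_apply o continuous_id continuous_const
  have hper : o.rotation ((0 : ℝ) : Real.Angle) x = o.rotation ((2 * π : ℝ) : Real.Angle) x := by
    rw [Real.Angle.coe_zero, Orientation.rotation_zero, rotation_two_pi,
      LinearIsometryEquiv.coe_refl, id]
  have h := two_mul_integral_mul_deriv_le two_pi_pos
    (fun t _ => hasDerivAt_comp_rotation o (hf.differentiable one_ne_zero) x t)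
    ((continuous_angularDeriv o hf).comp hrot).continuousOn (by rw [hper])
    (fun t _ => hasDerivAt_comp_rotation o (hg.differentiable one_ne_zero) x t)
    ((continuous_angularDeriv o hg).comp hrot).continuousOn (by rw [hper])
  rwa [sub_zero, div_self two_pi_pos.ne', one_mul] at h

variable [FiniteDimensional ℝ V] [MeasurableSpace V] [BorelSpace V]

theorem setIntegral_ball_comp_rotation (F : V → ℝ) (r : ℝ) (θ : Real.Angle) :
    ∫ x in Metric.ball 0 r, F (o.rotation θ x) = ∫ x in Metric.ball 0 r, F x := by
  have hball : o.rotation θ ⁻¹' Metric.ball 0 r = Metric.ball 0 r := by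
    simp only [LinearIsometryEquiv.preimage_ball, map_zero]
  conv_lhs => rw [← hball]
  exact (o.rotation θ).measurePreserving.setIntegral_preimage_emb
    (o.rotation θ).toHomeomorph.measurableEmbedding F _

theorem setIntegral_ball_integral_comp_rotation {F : V → ℝ} (hF : Continuous F) (r : ℝ) :
    ∫ x in Metric.ball 0 r, ∫ t in (0 : ℝ)..2 * π, F (o.rotation t x) =
      2 * π * ∫ x in Metric.ball 0 r, F x := by
  have hint : Integrable (Function.uncurry fun (t : ℝ) x => F (o.rotation t x))
      ((volume.restrict (Set.Ioc 0 (2 * π))).prod (volume.restrict (Metric.ball 0 r))) := by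
    rw [Measure.prod_restrict]
    refine IntegrableOn.mono_set (t := Set.Icc 0 (2 * π) ×ˢ Metric.closedBall (0 : V) r) ?_
      (Set.prod_mono Set.Ioc_subset_Icc_self Metric.ball_subset_closedBall)
    exact (hF.comp
      (continuous_rotation_apply o continuous_fst continuous_snd)).continuousOn.integrableOn_compact
      (isCompact_Icc.prod (isCompact_closedBall _ _))
  simp only [intervalIntegral.integral_of_le two_pi_pos.le]
  rw [← integral_integral_swap hint]
  simp only [setIntegral_ball_comp_rotation, setIntegral_const, smul_eq_mul, Real.volume_real_Ioc,
    sub_zero, max_eq_left two_pi_pos.le]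

theorem setIntegral_ball_mono_of_rotation {F G : V → ℝ} (hF : Continuous F) (hG : Continuous G)
    (hle : ∀ x, ∫ t in (0 : ℝ)..2 * π, F (o.rotation t x) ≤
      ∫ t in (0 : ℝ)..2 * π, G (o.rotation t x)) (r : ℝ) :
    ∫ x in Metric.ball 0 r, F x ≤ ∫ x in Metric.ball 0 r, G x := by
  have hint {F : V → ℝ} (hF : Continuous F) :
      IntegrableOn (fun x => ∫ t in (0 : ℝ)..2 * π, F (o.rotation t x)) (Metric.ball 0 r) := by
    refine integrableOn_ball_of_continuous
      (intervalIntegral.continuous_parametric_intervalIntegral_of_continuous' ?_ 0 (2 * π)) 0 r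
    exact hF.comp (continuous_rotation_apply o continuous_snd continuous_fst)
  refine le_of_mul_le_mul_left ?_ two_pi_pos
  rw [← setIntegral_ball_integral_comp_rotation o hF,
    ← setIntegral_ball_integral_comp_rotation o hG]
  exact integral_mono (hint hF) (hint hG) hle

theorem two_mul_setIntegral_mul_angularDeriv_le {c : ℝ → ℝ} (hc : Continuous c)
    (hc0 : ∀ r, 0 ≤ c r) {f g : V → ℝ} (hf : ContDiff ℝ 1 f) (hg : ContDiff ℝ 1 g) (r : ℝ) :
    ∫ x in Metric.ball 0 r, c ‖x‖ * (2 * (f x * angularDeriv o g x)) ≤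
      ∫ x in Metric.ball 0 r, c ‖x‖ * (angularDeriv o f x ^ 2 + angularDeriv o g x ^ 2) := by
  have hfc := hf.continuous
  have hf' := continuous_angularDeriv o hf
  have hg' := continuous_angularDeriv o hg
  refine setIntegral_ball_mono_of_rotation o (by fun_prop) (by fun_prop) (fun x => ?_) r
  simp only [LinearIsometryEquiv.norm_map, intervalIntegral.integral_const_mul]
  exact mul_le_mul_of_nonneg_left
    (two_mul_integral_mul_angularDeriv_comp_rotation_le o hf hg x) (hc0 _)

theorem setIntegral_mul_angularDeriv_le {c : ℝ → ℝ} (hc : Continuous c) (hc0 : ∀ r, 0 ≤ c r)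
    (hc1 : ∀ r, c r * r ^ 2 ≤ 1) {f g : V → ℝ} (hf : ContDiff ℝ 1 f) (hg : ContDiff ℝ 1 g)
    (r : ℝ) :
    ∫ x in Metric.ball 0 r, c ‖x‖ * (2 * (f x * angularDeriv o g x)) ≤
      ∫ x in Metric.ball 0 r, (‖fderiv ℝ f x‖ ^ 2 + ‖fderiv ℝ g x‖ ^ 2) := by
  have hf' := continuous_angularDeriv o hf
  have hg' := continuous_angularDeriv o hg
  refine (two_mul_setIntegral_mul_angularDeriv_le o hc hc0 hf hg r).trans
    (integral_mono (integrableOn_ball_of_continuous (by fun_prop) 0 r)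
      (integrableOn_ball_of_continuous (by fun_prop) 0 r) fun x => ?_)
  calc c ‖x‖ * (angularDeriv o f x ^ 2 + angularDeriv o g x ^ 2)
    _ ≤ c ‖x‖ * (‖x‖ ^ 2 * ‖fderiv ℝ f x‖ ^ 2 + ‖x‖ ^ 2 * ‖fderiv ℝ g x‖ ^ 2) :=
      mul_le_mul_of_nonneg_left (add_le_add (sq_angularDeriv_le o f x) (sq_angularDeriv_le o g x))
        (hc0 _)
    _ = c ‖x‖ * ‖x‖ ^ 2 * (‖fderiv ℝ f x‖ ^ 2 + ‖fderiv ℝ g x‖ ^ 2) := by ring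
    _ ≤ ‖fderiv ℝ f x‖ ^ 2 + ‖fderiv ℝ g x‖ ^ 2 := mul_le_of_le_one_left (by positivity) (hc1 _)

theorem abs_setIntegral_mul_angularDeriv_le {c : ℝ → ℝ} (hc : Continuous c) (hc0 : ∀ r, 0 ≤ c r)
    (hc1 : ∀ r, c r * r ^ 2 ≤ 1) {f g : V → ℝ} (hf : ContDiff ℝ 1 f) (hg : ContDiff ℝ 1 g)
    (r : ℝ) :
    |∫ x in Metric.ball 0 r, c ‖x‖ * (2 * (f x * angularDeriv o g x))| ≤
      ∫ x in Metric.ball 0 r, (‖fderiv ℝ f x‖ ^ 2 + ‖fderiv ℝ g x‖ ^ 2) := by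
  refine abs_le'.2 ⟨setIntegral_mul_angularDeriv_le o hc hc0 hc1 hf hg r, ?_⟩
  simpa only [neg_mul, mul_neg, integral_neg, fderiv_fun_neg, norm_neg] using
    setIntegral_mul_angularDeriv_le o hc hc0 hc1 hf.neg hg r

end Rotation

section PlaneCalculus

theorem norm_sq_eq_sum_sq_apply_single {ι : Type*} [Fintype ι] [DecidableEq ι]
    (L : EuclideanSpace ℝ ι →L[ℝ] ℝ) : ‖L‖ ^ 2 = ∑ j, L (EuclideanSpace.single j 1) ^ 2 := by
  rw [← (InnerProductSpace.toDual ℝ (EuclideanSpace ℝ ι)).symm.norm_map L,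
    EuclideanSpace.norm_sq_eq]
  refine Finset.sum_congr rfl fun j _ => ?_
  rw [← InnerProductSpace.toDual_symm_apply (𝕜 := ℝ) (y := L),
    EuclideanSpace.inner_single_right, one_mul, conj_trivial, Real.norm_eq_abs, sq_abs]

instance fact_finrank_plane : Fact (Module.finrank ℝ Plane = 2) := ⟨finrank_euclideanSpace_fin⟩

/-- The orientation of the plane in which the standard basis is positively oriented. -/
noncomputable def planeOrientation : Orientation ℝ Plane (Fin 2) :=
  (EuclideanSpace.basisFun (Fin 2) ℝ).toBasis.orientation

theorem rightAngleRotation_planeOrientation (x : Plane) :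
    planeOrientation.rightAngleRotation x = !₂[-x 1, x 0] := by
  refine ext_inner_right ℝ fun y => ?_
  rw [Orientation.inner_rightAngleRotation_left, Orientation.areaForm_to_volumeForm,
    planeOrientation.volumeForm_robust (EuclideanSpace.basisFun (Fin 2) ℝ) rfl,
    Module.Basis.det_apply, Matrix.det_fin_two]
  simp only [Module.Basis.toMatrix_apply, OrthonormalBasis.coe_toBasis_repr_apply,
    EuclideanSpace.basisFun_repr, Matrix.cons_val_zero, Matrix.cons_val_one, PiLp.inner_apply,
    RCLike.inner_apply, conj_trivial, Fin.sum_univ_two]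
  ring

theorem partialDeriv_eq_of_hasFDerivAt {F : Type*} [NormedAddCommGroup F] [NormedSpace ℝ F]
    {j : Fin 2} {f : Plane → F} {x : Plane} {f' : Plane →L[ℝ] F} (h : HasFDerivAt f f' x) :
    partialDeriv j f x = f' (EuclideanSpace.single j 1) := by
  rw [partialDeriv, h.fderiv]

theorem contDiff_partialDeriv {F : Type*} [NormedAddCommGroup F] [NormedSpace ℝ F]
    {f : Plane → F} {m n : WithTop ℕ∞} (hf : ContDiff ℝ n f) (hmn : m + 1 ≤ n) (j : Fin 2) :
    ContDiff ℝ m (partialDeriv j f) :=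
  (hf.fderiv_right hmn).clm_apply contDiff_const

theorem partialDeriv_coord (i j : Fin 2) (x : Plane) :
    partialDeriv j (fun y : Plane => y i) x = if i = j then 1 else 0 :=
  (partialDeriv_eq_of_hasFDerivAt (EuclideanSpace.proj i : Plane →L[ℝ] ℝ).hasFDerivAt).trans
    (by simp)

variable {f g : Plane → ℝ} {x : Plane}

theorem norm_sq_fderiv (f : Plane → ℝ) (x : Plane) :
    ‖fderiv ℝ f x‖ ^ 2 = ∑ j, partialDeriv j f x ^ 2 :=
  norm_sq_eq_sum_sq_apply_single (fderiv ℝ f x)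

theorem angularDeriv_planeOrientation (f : Plane → ℝ) (x : Plane) :
    angularDeriv planeOrientation f x = x 0 * partialDeriv 1 f x - x 1 * partialDeriv 0 f x := by
  have hbasis : !₂[-x 1, x 0] = x 0 • EuclideanSpace.single 1 (1 : ℝ) -
      x 1 • EuclideanSpace.single 0 (1 : ℝ) := by
    ext i
    fin_cases i <;> simp
  rw [angularDeriv, rightAngleRotation_planeOrientation, hbasis, map_sub, map_smul, map_smul,
    smul_eq_mul, smul_eq_mul, partialDeriv, partialDeriv]

theorem partialDeriv_mul (hf : DifferentiableAt ℝ f x) (hg : DifferentiableAt ℝ g x)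
    (j : Fin 2) :
    partialDeriv j (fun y => f y * g y) x =
      f x * partialDeriv j g x + partialDeriv j f x * g x := by
  simp only [partialDeriv, fderiv_fun_mul hf hg, add_apply, smul_apply,
    smul_eq_mul]
  ring

theorem partialDeriv_comm (hf : ContDiff ℝ 2 f) (i j : Fin 2) :
    partialDeriv i (partialDeriv j f) = partialDeriv j (partialDeriv i f) := by
  have hfderiv : Differentiable ℝ (fderiv ℝ f) :=
    (hf.fderiv_right (m := 1) (by norm_num)).differentiable one_ne_zero
  have hsnd (i j : Fin 2) (x : Plane) : partialDeriv i (partialDeriv j f) x =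
      fderiv ℝ (fderiv ℝ f) x (EuclideanSpace.single i 1) (EuclideanSpace.single j 1) := by
    unfold partialDeriv
    rw [fderiv_clm_apply (hfderiv x) (differentiableAt_const _)]
    simp
  ext x
  rw [hsnd, hsnd, hf.contDiffAt.isSymmSndFDerivAt (by simp)]

theorem curl_mul_gradient {c : Plane → ℝ} (hc : Differentiable ℝ c) (hg : ContDiff ℝ 2 g)
    (x : Plane) :
    partialDeriv 0 (fun y => c y * partialDeriv 1 g y) x -
        partialDeriv 1 (fun y => c y * partialDeriv 0 g y) x =
      partialDeriv 0 c x * partialDeriv 1 g x - partialDeriv 1 c x * partialDeriv 0 g x := by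
  have hg' (j : Fin 2) : DifferentiableAt ℝ (partialDeriv j g) x :=
    (contDiff_partialDeriv (m := 1) hg (by norm_num) j).differentiable one_ne_zero x
  rw [partialDeriv_mul (hc x) (hg' 1), partialDeriv_mul (hc x) (hg' 0), partialDeriv_comm hg 0 1]
  ring

theorem partialDeriv_apply {φ : Plane → Plane} (hφ : DifferentiableAt ℝ φ x) (i j : Fin 2) :
    partialDeriv j (fun y => φ y i) x = partialDeriv j φ x i :=
  partialDeriv_eq_of_hasFDerivAt
    ((EuclideanSpace.proj i : Plane →L[ℝ] ℝ).hasFDerivAt.comp x hφ.hasFDerivAt)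

end PlaneCalculus

namespace IsTestFunction

theorem apply {φ : Plane → Plane} (hφ : IsTestFunction φ) (i : Fin 2) :
    IsTestFunction (fun x => φ x i) where
  contDiff := (EuclideanSpace.proj i : Plane →L[ℝ] ℝ).contDiff.comp hφ.contDiff
  hasCompactSupport := hφ.hasCompactSupport.comp_left (g := fun y : Plane => y i) rfl
  tsupport_subset := (tsupport_comp_subset (g := fun y : Plane => y i) rfl φ).trans
    hφ.tsupport_subset

section

variable {F : Type*} [NormedAddCommGroup F] [NormedSpace ℝ F] {φ : Plane → F}

theorem differentiable (hφ : IsTestFunction φ) : Differentiable ℝ φ :=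
  hφ.contDiff.differentiable (by simp)

protected theorem partialDeriv (hφ : IsTestFunction φ) (j : Fin 2) :
    IsTestFunction (partialDeriv j φ) where
  contDiff := contDiff_partialDeriv hφ.contDiff le_rfl j
  hasCompactSupport := hφ.hasCompactSupport.fderiv_apply (𝕜 := ℝ) _
  tsupport_subset := (tsupport_fderiv_apply_subset ℝ _).trans hφ.tsupport_subset

theorem memLp (hφ : IsTestFunction φ) (p : ℝ≥0∞) : MemLp φ p :=
  hφ.contDiff.continuous.memLp_of_hasCompactSupport hφ.hasCompactSupport

theorem setIntegral_eq (hφ : IsTestFunction φ) : ∫ x in disc, φ x = ∫ x, φ x :=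
  setIntegral_eq_integral_of_forall_compl_eq_zero fun _ hx =>
    image_eq_zero_of_notMem_tsupport fun h => hx (hφ.tsupport_subset h)

theorem integrable (hφ : IsTestFunction φ) : Integrable φ :=
  memLp_one_iff_integrable.1 (hφ.memLp 1)

end

variable {f g : Plane → ℝ}

theorem mul (hf : IsTestFunction f) {c : Plane → ℝ} (hc : ContDiff ℝ ∞ c) :
    IsTestFunction (fun x => c x * f x) where
  contDiff := hc.mul hf.contDiff
  hasCompactSupport := hf.hasCompactSupport.mul_left
  tsupport_subset := (tsupport_mul_subset_right (f := c) (g := f)).trans hf.tsupport_subset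

theorem integral_mul_partialDeriv (hf : IsTestFunction f) {c : Plane → ℝ} (hc : ContDiff ℝ ∞ c)
    (j : Fin 2) :
    ∫ x in disc, c x * partialDeriv j f x =
      - ∫ x in disc, partialDeriv j c x * f x := by
  have hc' : ContDiff ℝ ∞ (partialDeriv j c) := contDiff_partialDeriv hc le_rfl j
  rw [((hf.partialDeriv j).mul hc).setIntegral_eq, (hf.mul hc').setIntegral_eq]
  exact integral_mul_fderiv_eq_neg_fderiv_mul_of_integrable (hf.mul hc').integrable
    ((hf.partialDeriv j).mul hc).integrable (hf.mul hc).integrable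
    (fun x _ => hc.differentiable (by simp) x) (fun x _ => hf.differentiable x)

/- The Jacobian determinant is a null Lagrangian: the second derivatives of `g` cancel. -/
theorem integral_mul_det_partialDeriv (hf : IsTestFunction f) (hg : ContDiff ℝ ∞ g)
    {c : Plane → ℝ} (hc : ContDiff ℝ ∞ c) :
    ∫ x in disc, c x * (partialDeriv 0 f x * partialDeriv 1 g x -
        partialDeriv 1 f x * partialDeriv 0 g x) =
      - ∫ x in disc, (partialDeriv 0 c x * partialDeriv 1 g x -
        partialDeriv 1 c x * partialDeriv 0 g x) * f x := by
  have hcg (j : Fin 2) : ContDiff ℝ ∞ fun x => c x * partialDeriv j g x :=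
    hc.mul (contDiff_partialDeriv hg le_rfl j)
  have hcg' (i j : Fin 2) : ContDiff ℝ ∞ (partialDeriv i fun x => c x * partialDeriv j g x) :=
    contDiff_partialDeriv (hcg j) le_rfl i
  calc _ = (∫ x in disc, c x * partialDeriv 1 g x * partialDeriv 0 f x) -
        ∫ x in disc, c x * partialDeriv 0 g x * partialDeriv 1 f x := by
        rw [← integral_sub ((hf.partialDeriv 0).mul (hcg 1)).integrable.restrict
          ((hf.partialDeriv 1).mul (hcg 0)).integrable.restrict]
        exact integral_congr_ae (ae_of_all _ fun x => by ring)
    _ = _ := by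
      rw [hf.integral_mul_partialDeriv (hcg 1), hf.integral_mul_partialDeriv (hcg 0), neg_sub_neg,
        ← neg_sub, ← integral_sub (hf.mul (hcg' 0 1)).integrable.restrict
          (hf.mul (hcg' 1 0)).integrable.restrict]
      simp only [← sub_mul, curl_mul_gradient (hc.differentiable (by simp))
        (contDiff_infty.1 hg 2)]

end IsTestFunction

section RegularizedWeights

variable {δ : ℝ} {x : Plane}

/-- The regularization `|x|² + δ²` of `|x|²`. -/
noncomputable def regSq (δ : ℝ) (x : Plane) : ℝ := ‖x‖ ^ 2 + δ ^ 2

theorem regSq_pos (hδ : δ ≠ 0) (x : Plane) : 0 < regSq δ x := by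
  unfold regSq
  positivity

theorem regSq_pos_of_ne_zero (δ : ℝ) (hx : x ≠ 0) : 0 < regSq δ x := by
  unfold regSq
  positivity

theorem contDiff_regSq {n : WithTop ℕ∞} (δ : ℝ) : ContDiff ℝ n (regSq δ) :=
  (contDiff_norm_sq ℝ).add contDiff_const

theorem partialDeriv_regSq (δ : ℝ) (j : Fin 2) (x : Plane) :
    partialDeriv j (regSq δ) x = 2 * x j := by
  refine (partialDeriv_eq_of_hasFDerivAt
    ((hasStrictFDerivAt_norm_sq x).hasFDerivAt.add_const (δ ^ 2))).trans ?_
  simp [EuclideanSpace.inner_single_right]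

theorem contDiff_log_regSq {n : WithTop ℕ∞} (hδ : δ ≠ 0) :
    ContDiff ℝ n fun x => Real.log (regSq δ x) :=
  (contDiff_regSq δ).log fun x => (regSq_pos hδ x).ne'

theorem partialDeriv_log_regSq (hδ : δ ≠ 0) (j : Fin 2) (x : Plane) :
    partialDeriv j (fun y => Real.log (regSq δ y)) x = 2 * x j / regSq δ x := by
  rw [partialDeriv, fderiv.log ((contDiff_regSq δ).differentiable one_ne_zero x)
    (regSq_pos hδ x).ne', smul_apply, smul_eq_mul, ← partialDeriv, partialDeriv_regSq,
    inv_mul_eq_div]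

/-- The regularization `(x ⊗ x + δ² 1) / (|x|² + δ²)` of the projection `x̂ ⊗ x̂`. The term `δ² 1`
makes its divergence an exact gradient. -/
noncomputable def radialTensor (δ : ℝ) (x : Plane) : Matrix (Fin 2) (Fin 2) ℝ :=
  Matrix.of fun i j => (x i * x j + if i = j then δ ^ 2 else 0) / regSq δ x

theorem radialTensor_apply (δ : ℝ) (x : Plane) (i j : Fin 2) :
    radialTensor δ x i j = (x i * x j + if i = j then δ ^ 2 else 0) / regSq δ x := rfl

theorem radialTensor_zero_apply (x : Plane) (i j : Fin 2) :
    radialTensor 0 x i j = radial x i * radial x j := by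
  rw [radialTensor_apply, regSq, zero_pow two_ne_zero, ite_self, add_zero, add_zero, radial,
    PiLp.smul_apply, PiLp.smul_apply, smul_eq_mul, smul_eq_mul]
  ring

theorem abs_radialTensor_apply_le_one (δ : ℝ) (x : Plane) (i j : Fin 2) :
    |radialTensor δ x i j| ≤ 1 := by
  have hx (i : Fin 2) : |x i| ≤ ‖x‖ := PiLp.norm_apply_le x i
  have hreg : 0 ≤ regSq δ x := by unfold regSq; positivity
  have hif : |if i = j then δ ^ 2 else 0| ≤ δ ^ 2 := by
    split_ifs
    · rw [abs_sq]
    · simp [sq_nonneg]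
  rw [radialTensor_apply, abs_div, abs_of_nonneg hreg]
  refine div_le_one_of_le₀ ((abs_add_le _ _).trans ?_) hreg
  rw [abs_mul, regSq, sq ‖x‖]
  exact add_le_add (mul_le_mul (hx i) (hx j) (abs_nonneg _) (norm_nonneg _)) hif

theorem contDiff_radialTensor_apply {n : WithTop ℕ∞} (hδ : δ ≠ 0) (i j : Fin 2) :
    ContDiff ℝ n fun x => radialTensor δ x i j :=
  (((contDiff_piLp_apply 2).mul (contDiff_piLp_apply 2)).add contDiff_const).div
    (contDiff_regSq δ) fun x => (regSq_pos hδ x).ne'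

theorem measurable_radialTensor_apply (δ : ℝ) (i j : Fin 2) :
    Measurable fun x => radialTensor δ x i j := by
  have := (contDiff_regSq (n := 0) δ).continuous.measurable
  unfold radialTensor
  simp only [Matrix.of_apply]
  fun_prop

theorem tendsto_radialTensor_apply (hx : x ≠ 0) (i j : Fin 2) :
    Tendsto (fun δ => radialTensor δ x i j) (𝓝 0) (𝓝 (radialTensor 0 x i j)) := by
  have hcont : ContinuousAt (fun δ : ℝ => (x i * x j + if i = j then δ ^ 2 else 0) /
      (‖x‖ ^ 2 + δ ^ 2)) 0 := by
    refine ContinuousAt.div ?_ (by fun_prop) (regSq_pos_of_ne_zero 0 hx).ne'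
    split_ifs <;> fun_prop
  exact hcont

theorem sum_radialTensor_mul (hδ : δ ≠ 0) (x : Plane) (i : Fin 2) :
    ∑ j, radialTensor δ x i j * x j = x i := by
  simp only [radialTensor_apply, div_mul_eq_mul_div, add_mul, mul_assoc, ite_mul, zero_mul]
  rw [← Finset.sum_div, Finset.sum_add_distrib, ← Finset.mul_sum, Finset.sum_ite_eq,
    if_pos (Finset.mem_univ i), div_eq_iff (regSq_pos hδ x).ne', regSq, EuclideanSpace.norm_sq_eq]
  simp only [Real.norm_eq_abs, sq_abs]
  simp only [sq]
  ring

/- Differentiating `radialTensor δ x i j * regSq δ x = x i * x j + const` by the product rule. -/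
theorem partialDeriv_radialTensor (hδ : δ ≠ 0) (i j : Fin 2) (x : Plane) :
    partialDeriv j (fun y => radialTensor δ y i j) x * regSq δ x =
      x i + (if i = j then x j else 0) - 2 * (radialTensor δ x i j * x j) := by
  have hcoord (j : Fin 2) : DifferentiableAt ℝ (fun y : Plane => y j) x :=
    (contDiff_piLp_apply 2).differentiable one_ne_zero x
  have hprod : (fun y => radialTensor δ y i j * regSq δ y) =
      fun y => y i * y j + if i = j then δ ^ 2 else 0 :=
    funext fun y => div_mul_cancel₀ _ (regSq_pos hδ y).ne'
  have hderiv := congrArg (fun f => partialDeriv j f x) hprod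
  simp only [partialDeriv_mul ((contDiff_radialTensor_apply hδ i j).differentiable one_ne_zero x)
    ((contDiff_regSq δ).differentiable one_ne_zero x), partialDeriv_regSq] at hderiv
  rw [partialDeriv, partialDeriv, fderiv_add_const, ← partialDeriv, ← partialDeriv,
    partialDeriv_mul (hcoord i) (hcoord j), partialDeriv_coord, partialDeriv_coord, if_pos rfl,
    mul_one, ite_mul, one_mul, zero_mul] at hderiv
  linarith

theorem sum_partialDeriv_radialTensor (hδ : δ ≠ 0) (i : Fin 2) (x : Plane) :
    ∑ j, partialDeriv j (fun y => radialTensor δ y i j) x =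
      2⁻¹ * partialDeriv i (fun y => Real.log (regSq δ y)) x := by
  rw [← mul_left_inj' (regSq_pos hδ x).ne', Finset.sum_mul, partialDeriv_log_regSq hδ, mul_assoc,
    div_mul_cancel₀ _ (regSq_pos hδ x).ne']
  simp only [partialDeriv_radialTensor hδ, Finset.sum_add_distrib, Finset.sum_sub_distrib,
    ← Finset.mul_sum, sum_radialTensor_mul hδ, Finset.sum_const, Finset.card_univ,
    Fintype.card_fin, Finset.sum_ite_eq, Finset.mem_univ, if_true, nsmul_eq_mul, Nat.cast_ofNat]
  ring

end RegularizedWeights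

/-- The Jacobian matrix `(∇φ)_{ij} = ∂_j φ_i` of a differentiable map. -/
noncomputable def jacobian (φ : Plane → Plane) (x : Plane) : Matrix (Fin 2) (Fin 2) ℝ :=
  Matrix.of fun i j => partialDeriv j φ x i

/-- The squared Frobenius norm `|ξ|²` of a matrix. -/
def frobeniusSq (ξ : Matrix (Fin 2) (Fin 2) ℝ) : ℝ := ∑ i, ∑ j, ξ i j ^ 2

theorem frobeniusSq_nonneg (ξ : Matrix (Fin 2) (Fin 2) ℝ) : 0 ≤ frobeniusSq ξ :=
  Finset.sum_nonneg fun _ _ => Finset.sum_nonneg fun _ _ => sq_nonneg _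

theorem eq_zero_of_frobeniusSq_eq_zero {ξ : Matrix (Fin 2) (Fin 2) ℝ} (h : frobeniusSq ξ = 0) :
    ξ = 0 := by
  ext i j
  have hrow := (Finset.sum_eq_zero_iff_of_nonneg fun _ _ =>
    Finset.sum_nonneg fun _ _ => sq_nonneg _).1 h i (Finset.mem_univ i)
  exact sq_eq_zero_iff.1
    ((Finset.sum_eq_zero_iff_of_nonneg fun _ _ => sq_nonneg _).1 hrow j (Finset.mem_univ j))

theorem frobeniusSq_jacobian {φ : Plane → Plane} {x : Plane} (hφ : DifferentiableAt ℝ φ x) :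
    frobeniusSq (jacobian φ x) =
      ‖fderiv ℝ (fun y => φ y 0) x‖ ^ 2 + ‖fderiv ℝ (fun y => φ y 1) x‖ ^ 2 := by
  simp only [frobeniusSq, jacobian, Matrix.of_apply, Fin.sum_univ_two (M := ℝ), norm_sq_fderiv,
    partialDeriv_apply hφ]

theorem IsTestFunction.abs_integral_log_mul_det_le {φ : Plane → Plane} (hφ : IsTestFunction φ)
    {δ : ℝ} (hδ : δ ≠ 0) :
    |∫ x in disc, Real.log (regSq δ x) * (jacobian φ x).det| ≤
      ∫ x in disc, frobeniusSq (jacobian φ x) := by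
  have hne (r : ℝ) : r ^ 2 + δ ^ 2 ≠ 0 := by positivity
  have hcont : Continuous fun r : ℝ => (r ^ 2 + δ ^ 2)⁻¹ := by fun_prop (disch := exact hne _)
  have hle (r : ℝ) : (r ^ 2 + δ ^ 2)⁻¹ * r ^ 2 ≤ 1 := by
    rw [inv_mul_eq_div]
    exact div_le_one_of_le₀ (le_add_of_nonneg_right (sq_nonneg δ)) (by positivity)
  have hisop := abs_setIntegral_mul_angularDeriv_le planeOrientation hcont
    (fun r => by positivity) hle (contDiff_infty.1 (hφ.apply 0).contDiff 1)
    (contDiff_infty.1 (hφ.apply 1).contDiff 1) 1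
  have hnull := (hφ.apply 0).integral_mul_det_partialDeriv (hφ.apply 1).contDiff
    (contDiff_log_regSq hδ)
  simp only [Matrix.det_fin_two, frobeniusSq_jacobian (hφ.differentiable _)]
  simp only [jacobian, Matrix.of_apply, ← partialDeriv_apply (hφ.differentiable _)]
  rw [hnull, abs_neg]
  refine le_of_eq_of_le (congrArg abs (integral_congr_ae (ae_of_all _ fun x => ?_))) hisop
  simp only [partialDeriv_log_regSq hδ, angularDeriv_planeOrientation]
  simp only [regSq]
  ring

section Limits

variable {α ι : Type*} [MeasurableSpace α] {μ : Measure α} {l : Filter ι}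

theorem tendsto_integral_mul_of_tendsto_eLpNorm {f g : ι → α → ℝ} {F G : α → ℝ}
    (hf : ∀ n, MemLp (f n) 2 μ) (hg : ∀ n, MemLp (g n) 2 μ) (hF : MemLp F 2 μ) (hG : MemLp G 2 μ)
    (hfF : Tendsto (fun n => eLpNorm (f n - F) 2 μ) l (𝓝 0))
    (hgG : Tendsto (fun n => eLpNorm (g n - G) 2 μ) l (𝓝 0)) :
    Tendsto (fun n => ∫ x, f n x * g n x ∂μ) l (𝓝 (∫ x, F x * G x ∂μ)) := by
  have inner_toLp {u v : α → ℝ} (hu : MemLp u 2 μ) (hv : MemLp v 2 μ) :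
      inner ℝ (hu.toLp u) (hv.toLp v) = ∫ x, u x * v x ∂μ := by
    rw [L2.inner_def]
    refine integral_congr_ae ?_
    filter_upwards [hu.coeFn_toLp, hv.coeFn_toLp] with x hux hvx
    rw [hux, hvx, RCLike.inner_apply, conj_trivial, mul_comm]
  simpa only [inner_toLp] using ((Lp.tendsto_Lp_iff_tendsto_eLpNorm'' f hf F hF).2 hfF).inner
    (𝕜 := ℝ) ((Lp.tendsto_Lp_iff_tendsto_eLpNorm'' g hg G hG).2 hgG)

theorem tendsto_eLpNorm_mul_sub {p : ℝ≥0∞} {c : α → ℝ} {f : ι → α → ℝ} {F : α → ℝ}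
    (hc : MemLp c ∞ μ) (hf : ∀ n, MemLp (f n) p μ) (hF : MemLp F p μ)
    (hfF : Tendsto (fun n => eLpNorm (f n - F) p μ) l (𝓝 0)) :
    Tendsto (fun n => eLpNorm ((fun x => c x * f n x) - fun x => c x * F x) p μ) l (𝓝 0) := by
  have hlim := ENNReal.Tendsto.const_mul hfF (Or.inr hc.eLpNorm_ne_top)
  rw [mul_zero] at hlim
  refine tendsto_of_tendsto_of_tendsto_of_le_of_le tendsto_const_nhds hlim (fun _ => zero_le)
    fun n => ?_
  refine (eLpNorm_congr_ae (ae_of_all _ fun x => ?_)).trans_le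
    (eLpNorm_smul_le_mul_eLpNorm ((hf n).sub hF).1 hc.1)
  simp only [Pi.sub_apply, Pi.smul_apply', smul_eq_mul, mul_sub]

theorem tendsto_integral_mul_mul_of_tendsto_eLpNorm {c : α → ℝ} {f g : ι → α → ℝ} {F G : α → ℝ}
    (hc : MemLp c ∞ μ) (hf : ∀ n, MemLp (f n) 2 μ) (hg : ∀ n, MemLp (g n) 2 μ)
    (hF : MemLp F 2 μ) (hG : MemLp G 2 μ)
    (hfF : Tendsto (fun n => eLpNorm (f n - F) 2 μ) l (𝓝 0))
    (hgG : Tendsto (fun n => eLpNorm (g n - G) 2 μ) l (𝓝 0)) :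
    Tendsto (fun n => ∫ x, c x * (f n x * g n x) ∂μ) l (𝓝 (∫ x, c x * (F x * G x) ∂μ)) := by
  simp only [← mul_assoc]
  exact tendsto_integral_mul_of_tendsto_eLpNorm (fun n => (hf n).mul hc) hg (hF.mul hc) hG
    (tendsto_eLpNorm_mul_sub hc hf hF hfF) hgG

variable {A : ι → α → Matrix (Fin 2) (Fin 2) ℝ} {B : α → Matrix (Fin 2) (Fin 2) ℝ}

theorem integrable_frobeniusSq (hB : ∀ i j, MemLp (fun x => B x i j) 2 μ) :
    Integrable (fun x => frobeniusSq (B x)) μ :=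
  integrable_finsetSum _ fun i _ => integrable_finsetSum _ fun j _ => (hB i j).integrable_sq

theorem integral_frobeniusSq (hB : ∀ i j, MemLp (fun x => B x i j) 2 μ) :
    ∫ x, frobeniusSq (B x) ∂μ = ∑ i, ∑ j, ∫ x, B x i j ^ 2 ∂μ := by
  unfold frobeniusSq
  rw [integral_finsetSum _ fun i _ => integrable_finsetSum _ fun j _ => (hB i j).integrable_sq]
  exact Finset.sum_congr rfl fun i _ => integral_finsetSum _ fun j _ => (hB i j).integrable_sq

theorem tendsto_integral_frobeniusSq (hA : ∀ n i j, MemLp (fun x => A n x i j) 2 μ)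
    (hB : ∀ i j, MemLp (fun x => B x i j) 2 μ)
    (hAB : ∀ i j, Tendsto (fun n => eLpNorm ((fun x => A n x i j) - fun x => B x i j) 2 μ) l
      (𝓝 0)) :
    Tendsto (fun n => ∫ x, frobeniusSq (A n x) ∂μ) l (𝓝 (∫ x, frobeniusSq (B x) ∂μ)) := by
  simp only [integral_frobeniusSq (hA _), integral_frobeniusSq hB, sq]
  exact tendsto_finsetSum _ fun i _ => tendsto_finsetSum _ fun j _ =>
    tendsto_integral_mul_of_tendsto_eLpNorm (hA · i j) (hA · i j) (hB i j) (hB i j)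
      (hAB i j) (hAB i j)

theorem integral_mul_det {c : α → ℝ} (hc : MemLp c ∞ μ)
    (hB : ∀ i j, MemLp (fun x => B x i j) 2 μ) :
    ∫ x, c x * (B x).det ∂μ =
      ∫ x, c x * (B x 0 0 * B x 1 1) ∂μ - ∫ x, c x * (B x 0 1 * B x 1 0) ∂μ := by
  have hint (i j k m : Fin 2) : Integrable (fun x => c x * (B x i j * B x k m)) μ :=
    memLp_one_iff_integrable.1
      ((memLp_one_iff_integrable.2 ((hB i j).integrable_mul (hB k m))).mul hc)
  simp only [Matrix.det_fin_two, mul_sub]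
  exact integral_sub (hint 0 0 1 1) (hint 0 1 1 0)

theorem tendsto_integral_mul_det {c : α → ℝ} (hc : MemLp c ∞ μ)
    (hA : ∀ n i j, MemLp (fun x => A n x i j) 2 μ) (hB : ∀ i j, MemLp (fun x => B x i j) 2 μ)
    (hAB : ∀ i j, Tendsto (fun n => eLpNorm ((fun x => A n x i j) - fun x => B x i j) 2 μ) l
      (𝓝 0)) :
    Tendsto (fun n => ∫ x, c x * (A n x).det ∂μ) l (𝓝 (∫ x, c x * (B x).det ∂μ)) := by
  have hlim (i j k m : Fin 2) := tendsto_integral_mul_mul_of_tendsto_eLpNorm hc (hA · i j)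
    (hA · k m) (hB i j) (hB k m) (hAB i j) (hAB k m)
  simp only [integral_mul_det hc (hA _), integral_mul_det hc hB]
  exact (hlim 0 0 1 1).sub (hlim 0 1 1 0)

end Limits

section SobolevZero

instance isFiniteMeasure_discMeasure : IsFiniteMeasure discMeasure :=
  isFiniteMeasure_restrict.2 measure_ball_lt_top.ne

theorem memLp_discMeasure_of_continuous {E : Type*} [NormedAddCommGroup E] {c : Plane → E}
    (hc : Continuous c) (p : ℝ≥0∞) : MemLp c p discMeasure :=
  memLp_restrict_of_continuousOn_isCompact (isCompact_closedBall 0 1)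
    Metric.isClosed_closedBall.measurableSet hc.continuousOn Metric.ball_subset_closedBall

theorem memLp_apply {v : Plane → Plane} {p : ℝ≥0∞} {μ : Measure Plane} (hv : MemLp v p μ)
    (i : Fin 2) : MemLp (fun x => v x i) p μ :=
  (EuclideanSpace.proj i : Plane →L[ℝ] ℝ).comp_memLp' hv

theorem IsTestFunction.memLp_jacobian {φ : Plane → Plane} (hφ : IsTestFunction φ) (p : ℝ≥0∞)
    (i j : Fin 2) : MemLp (fun x => jacobian φ x i j) p discMeasure :=
  (((hφ.partialDeriv j).apply i).memLp p).restrict _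

namespace MemW120

variable {u : Plane → Plane}

theorem memLp_weakGradient (hu : MemW120 u) (i j : Fin 2) :
    MemLp (fun x => weakGradient u x i j) 2 discMeasure :=
  hu.1.hasWeakGradient.memLp i j

theorem exists_tendsto_jacobian (hu : MemW120 u) : ∃ ψ : ℕ → Plane → Plane,
    (∀ n, IsTestFunction (ψ n)) ∧
    (∀ i, Tendsto (fun n => eLpNorm ((fun x => ψ n x i) - fun x => u x i) 2 discMeasure) atTop
      (𝓝 0)) ∧
    ∀ i j, Tendsto (fun n => eLpNorm ((fun x => jacobian (ψ n) x i j) -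
      fun x => weakGradient u x i j) 2 discMeasure) atTop (𝓝 0) := by
  obtain ⟨ψ, hψ, hψu, hgrad⟩ := hu.2
  refine ⟨ψ, hψ, fun i => ?_, hgrad⟩
  exact tendsto_of_tendsto_of_tendsto_of_le_of_le tendsto_const_nhds hψu (fun _ => zero_le)
    fun n => eLpNorm_mono fun x => PiLp.norm_apply_le (ψ n x - u x) i

theorem integral_mul_weakGradient (hu : MemW120 u) {c : Plane → ℝ} (hc : ContDiff ℝ ∞ c)
    (i j : Fin 2) :
    ∫ x in disc, c x * weakGradient u x i j = - ∫ x in disc, partialDeriv j c x * u x i := by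
  obtain ⟨ψ, hψ, hψu, hgrad⟩ := hu.exists_tendsto_jacobian
  have hc' := memLp_discMeasure_of_continuous
    (contDiff_partialDeriv (m := ∞) hc le_rfl j).continuous 2
  have hL := tendsto_integral_mul_of_tendsto_eLpNorm
    (fun _ => memLp_discMeasure_of_continuous hc.continuous 2)
    (fun n => (hψ n).memLp_jacobian 2 i j) (memLp_discMeasure_of_continuous hc.continuous 2)
    (hu.memLp_weakGradient i j) (by simp) (hgrad i j)
  have hR := (tendsto_integral_mul_of_tendsto_eLpNorm (fun _ => hc')
    (fun n => (((hψ n).apply i).memLp 2).restrict _) hc' (memLp_apply hu.1.1 i) (by simp)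
    (hψu i)).neg
  refine tendsto_nhds_unique (hL.congr fun n => ?_) hR
  rw [← ((hψ n).apply i).integral_mul_partialDeriv hc j]
  simp only [partialDeriv_apply ((hψ n).differentiable _)]
  rfl

theorem integral_weakGradient (hu : MemW120 u) (i j : Fin 2) :
    ∫ x in disc, weakGradient u x i j = 0 := by
  have h := hu.integral_mul_weakGradient (c := fun _ => 1) contDiff_const i j
  simpa [partialDeriv] using h

theorem abs_integral_log_mul_det_le (hu : MemW120 u) {δ : ℝ} (hδ : δ ≠ 0) :
    |∫ x in disc, Real.log (regSq δ x) * (weakGradient u x).det| ≤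
      ∫ x in disc, frobeniusSq (weakGradient u x) := by
  obtain ⟨ψ, hψ, -, hgrad⟩ := hu.exists_tendsto_jacobian
  have hlog := memLp_discMeasure_of_continuous (contDiff_log_regSq (n := 0) hδ).continuous ∞
  exact le_of_tendsto_of_tendsto'
    (tendsto_integral_mul_det hlog (fun n => (hψ n).memLp_jacobian 2) hu.memLp_weakGradient
      hgrad).abs
    (tendsto_integral_frobeniusSq (fun n => (hψ n).memLp_jacobian 2) hu.memLp_weakGradient hgrad)
    fun n => (hψ n).abs_integral_log_mul_det_le hδ

end MemW120
end SobolevZero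

section RadialForm

variable {H : Plane → Matrix (Fin 2) (Fin 2) ℝ} {u : Plane → Plane} {δ : ℝ}

/-- The contraction of `ξ` with `radialTensor δ x`; for `δ = 0` it is the form `x̂ · ξ x̂`. -/
noncomputable def radialForm (δ : ℝ) (x : Plane) (ξ : Matrix (Fin 2) (Fin 2) ℝ) : ℝ :=
  ∑ i, ∑ j, radialTensor δ x i j * ξ i j

theorem memLp_radialTensor_apply (δ : ℝ) (i j : Fin 2) (p : ℝ≥0∞) :
    MemLp (fun x => radialTensor δ x i j) p discMeasure :=
  MemLp.of_bound (measurable_radialTensor_apply δ i j).aestronglyMeasurable 1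
    (ae_of_all _ fun x => abs_radialTensor_apply_le_one δ x i j)

theorem integrable_radialTensor_mul (hH : ∀ i j, MemLp (fun x => H x i j) 2 discMeasure)
    (δ : ℝ) (i j : Fin 2) :
    Integrable (fun x => radialTensor δ x i j * H x i j) discMeasure :=
  (memLp_radialTensor_apply δ i j 2).integrable_mul (hH i j)

theorem integrable_radialForm (hH : ∀ i j, MemLp (fun x => H x i j) 2 discMeasure) (δ : ℝ) :
    Integrable (fun x => radialForm δ x (H x)) discMeasure :=
  integrable_finsetSum _ fun i _ => integrable_finsetSum _ fun j _ =>
    integrable_radialTensor_mul hH δ i j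

theorem integral_radialForm (hH : ∀ i j, MemLp (fun x => H x i j) 2 discMeasure) (δ : ℝ) :
    ∫ x in disc, radialForm δ x (H x) =
      ∑ i, ∑ j, ∫ x in disc, radialTensor δ x i j * H x i j := by
  have hint := integrable_radialTensor_mul hH δ
  unfold radialForm
  rw [integral_finsetSum _ fun i _ => integrable_finsetSum _ fun j _ => hint i j]
  exact Finset.sum_congr rfl fun i _ => integral_finsetSum _ fun j _ => hint i j

theorem ae_discMeasure_ne_zero : ∀ᵐ x ∂discMeasure, x ≠ 0 :=
  ae_restrict_of_ae (Measure.ae_ne volume 0)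

theorem tendsto_integral_radialForm (hH : ∀ i j, MemLp (fun x => H x i j) 2 discMeasure) :
    Tendsto (fun δ => ∫ x in disc, radialForm δ x (H x)) (𝓝 0)
      (𝓝 (∫ x in disc, radialForm 0 x (H x))) := by
  simp only [integral_radialForm hH]
  refine tendsto_finsetSum _ fun i _ => tendsto_finsetSum _ fun j _ =>
    tendsto_integral_filter_of_dominated_convergence (fun x => ‖H x i j‖)
      (Eventually.of_forall fun δ => (integrable_radialTensor_mul hH δ i j).1)
      (Eventually.of_forall fun δ => ae_of_all _ fun x => ?_)
      ((hH i j).integrable one_le_two).norm ?_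
  · rw [norm_mul]
    exact mul_le_of_le_one_left (norm_nonneg _) (abs_radialTensor_apply_le_one δ x i j)
  · filter_upwards [ae_discMeasure_ne_zero] with x hx
    exact (tendsto_radialTensor_apply hx i j).mul_const _

namespace MemW120

theorem integral_radialTensor_mul (hu : MemW120 u) (hδ : δ ≠ 0) (i : Fin 2) :
    ∑ j, ∫ x in disc, radialTensor δ x i j * weakGradient u x i j =
      2⁻¹ * ∫ x in disc, Real.log (regSq δ x) * weakGradient u x i i := by
  have hint (j : Fin 2) : Integrable
      (fun x => partialDeriv j (fun y => radialTensor δ y i j) x * u x i) discMeasure :=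
    (memLp_discMeasure_of_continuous (contDiff_partialDeriv (m := 0) (n := 1)
      (contDiff_radialTensor_apply hδ i j) le_rfl j).continuous 2).integrable_mul
      (memLp_apply hu.1.1 i)
  simp only [hu.integral_mul_weakGradient (contDiff_radialTensor_apply hδ i _),
    hu.integral_mul_weakGradient (contDiff_log_regSq hδ)]
  rw [Finset.sum_neg_distrib, ← integral_finsetSum _ fun j _ => hint j, mul_neg,
    ← integral_const_mul]
  simp only [← Finset.sum_mul, sum_partialDeriv_radialTensor hδ, mul_assoc]

theorem integral_radialForm_eq_integral_log_mul_trace (hu : MemW120 u) (hδ : δ ≠ 0) :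
    ∫ x in disc, radialForm δ x (weakGradient u x) =
      2⁻¹ * ∫ x in disc, Real.log (regSq δ x) * (weakGradient u x).trace := by
  have hint (i : Fin 2) : Integrable
      (fun x => Real.log (regSq δ x) * weakGradient u x i i) discMeasure :=
    (memLp_discMeasure_of_continuous
      (contDiff_log_regSq (n := 0) hδ).continuous 2).integrable_mul (hu.memLp_weakGradient i i)
  simp only [Matrix.trace, Matrix.diag_apply, Finset.mul_sum]
  rw [integral_radialForm hu.memLp_weakGradient, integral_finsetSum _ fun i _ => hint i,
    Finset.mul_sum]
  exact Finset.sum_congr rfl fun i _ => hu.integral_radialTensor_mul hδ i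

theorem abs_integral_radialForm_le (hu : MemW120 u)
    (htr : ∀ᵐ x ∂discMeasure, (weakGradient u x).trace = -(weakGradient u x).det) :
    |∫ x in disc, radialForm 0 x (weakGradient u x)| ≤
      2⁻¹ * ∫ x in disc, frobeniusSq (weakGradient u x) := by
  refine le_of_tendsto (f := fun δ => |∫ x in disc, radialForm δ x (weakGradient u x)|)
    ((tendsto_integral_radialForm hu.memLp_weakGradient).abs.mono_left
      (nhdsWithin_le_nhds (s := {0}ᶜ))) (eventually_mem_nhdsWithin.mono fun δ hδ => ?_)
  rw [hu.integral_radialForm_eq_integral_log_mul_trace hδ, abs_mul,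
    abs_of_pos (inv_pos.2 two_pos)]
  refine mul_le_mul_of_nonneg_left ?_ (inv_nonneg.2 zero_le_two)
  have hlog : ∫ x in disc, Real.log (regSq δ x) * (weakGradient u x).trace =
      -∫ x in disc, Real.log (regSq δ x) * (weakGradient u x).det := by
    rw [← integral_neg]
    refine integral_congr_ae ?_
    filter_upwards [htr] with x hx
    rw [hx, mul_neg]
  rw [hlog, abs_neg]
  exact hu.abs_integral_log_mul_det_le hδ

end MemW120

end RadialForm

section Poincare

theorem norm_fderiv_le_sum_norm_partialDeriv (f : Plane → ℝ) (x : Plane) :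
    ‖fderiv ℝ f x‖ ≤ ∑ j, ‖partialDeriv j f x‖ := by
  refine le_of_sq_le_sq ?_ (Finset.sum_nonneg fun j _ => norm_nonneg _)
  rw [norm_sq_fderiv]
  simpa only [Real.norm_eq_abs, sq_abs] using Finset.sum_sq_le_sq_sum_of_nonneg
    fun j (_ : j ∈ Finset.univ) => norm_nonneg (partialDeriv j f x)

theorem eLpNorm_fderiv_le_sum_eLpNorm_partialDeriv {f : Plane → ℝ} (hf : ContDiff ℝ 1 f)
    {p : ℝ≥0∞} (hp : 1 ≤ p) (μ : Measure Plane) :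
    eLpNorm (fderiv ℝ f) p μ ≤ ∑ j, eLpNorm (partialDeriv j f) p μ :=
  calc eLpNorm (fderiv ℝ f) p μ
    _ ≤ eLpNorm (∑ j, fun x => ‖partialDeriv j f x‖) p μ :=
      eLpNorm_mono_real fun x => by
        simpa only [Finset.sum_apply] using norm_fderiv_le_sum_norm_partialDeriv f x
    _ ≤ ∑ j, eLpNorm (fun x => ‖partialDeriv j f x‖) p μ :=
      eLpNorm_sum_le (fun j _ => (contDiff_partialDeriv (m := 0) hf
        (by norm_num) j).continuous.norm.aestronglyMeasurable) hp
    _ = ∑ j, eLpNorm (partialDeriv j f) p μ := by simp only [eLpNorm_norm]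

theorem exists_eLpNorm_two_le_mul_eLpNorm_one_fderiv : ∃ K : NNReal, ∀ f : Plane → ℝ,
    ContDiff ℝ 1 f → Function.support f ⊆ disc →
      eLpNorm f 2 volume ≤ K * eLpNorm (fderiv ℝ f) 1 volume := by
  refine ⟨eLpNormLESNormFDerivOfLeConst ℝ (volume : Measure Plane) disc 1 2,
    fun f hf hsupp => ?_⟩
  exact eLpNorm_le_eLpNorm_fderiv_of_le volume hf hsupp (p := 1) (q := 2) le_rfl
    (by rw [finrank_euclideanSpace_fin]; norm_num)
    (by rw [finrank_euclideanSpace_fin]; norm_num) Metric.isBounded_ball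

theorem IsTestFunction.eLpNorm_discMeasure {f : Plane → ℝ} (hf : IsTestFunction f) (p : ℝ≥0∞) :
    eLpNorm f p discMeasure = eLpNorm f p volume :=
  eLpNorm_restrict_eq_of_support_subset ((subset_tsupport f).trans hf.tsupport_subset)

theorem exists_eLpNorm_le_mul_sum_eLpNorm_partialDeriv : ∃ C : ℝ≥0∞, C ≠ ⊤ ∧
    ∀ f : Plane → ℝ, IsTestFunction f →
      eLpNorm f 2 discMeasure ≤ C * ∑ j, eLpNorm (partialDeriv j f) 2 discMeasure := by
  obtain ⟨K, hK⟩ := exists_eLpNorm_two_le_mul_eLpNorm_one_fderiv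
  set M := discMeasure Set.univ ^ (1 / (1 : ℝ≥0∞).toReal - 1 / (2 : ℝ≥0∞).toReal) with hM
  have hM_ne_top : M ≠ ⊤ := ENNReal.rpow_ne_top_of_nonneg (by norm_num) (measure_ne_top _ _)
  refine ⟨K * M, ENNReal.mul_ne_top ENNReal.coe_ne_top hM_ne_top, fun f hf => ?_⟩
  have hf1 : ContDiff ℝ 1 f := contDiff_infty.1 hf.contDiff 1
  have hholder (j : Fin 2) :
      eLpNorm (partialDeriv j f) 1 discMeasure ≤ M * eLpNorm (partialDeriv j f) 2 discMeasure := by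
    rw [mul_comm, hM]
    exact eLpNorm_le_eLpNorm_mul_rpow_measure_univ one_le_two
      (hf.partialDeriv j).contDiff.continuous.aestronglyMeasurable
  calc eLpNorm f 2 discMeasure
    _ = eLpNorm f 2 volume := hf.eLpNorm_discMeasure 2
    _ ≤ K * eLpNorm (fderiv ℝ f) 1 volume :=
      hK f hf1 ((subset_tsupport f).trans hf.tsupport_subset)
    _ ≤ K * ∑ j, eLpNorm (partialDeriv j f) 1 volume := by
      gcongr
      exact eLpNorm_fderiv_le_sum_eLpNorm_partialDeriv hf1 le_rfl _
    _ = K * ∑ j, eLpNorm (partialDeriv j f) 1 discMeasure := by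
      simp only [(hf.partialDeriv _).eLpNorm_discMeasure]
    _ ≤ K * ∑ j, M * eLpNorm (partialDeriv j f) 2 discMeasure := by
      gcongr with j
      exact hholder j
    _ = K * M * ∑ j, eLpNorm (partialDeriv j f) 2 discMeasure := by
      rw [← Finset.mul_sum, mul_assoc]

theorem MemW120.ae_eq_zero {u : Plane → Plane} (hu : MemW120 u)
    (hgrad : weakGradient u =ᵐ[discMeasure] 0) : u =ᵐ[discMeasure] 0 := by
  obtain ⟨ψ, hψ, hψu, hψgrad⟩ := hu.exists_tendsto_jacobian
  obtain ⟨C, hC, hpoincare⟩ := exists_eLpNorm_le_mul_sum_eLpNorm_partialDeriv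
  have hpartial (i j : Fin 2) : Tendsto
      (fun n => eLpNorm (partialDeriv j fun x => ψ n x i) 2 discMeasure) atTop (𝓝 0) := by
    refine (hψgrad i j).congr fun n => eLpNorm_congr_ae ?_
    filter_upwards [hgrad] with x hx
    rw [partialDeriv_apply ((hψ n).differentiable x), Pi.sub_apply, hx, Pi.zero_apply,
      Matrix.zero_apply, sub_zero, jacobian, Matrix.of_apply]
  have hzero (i : Fin 2) :
      Tendsto (fun n => eLpNorm (fun x => ψ n x i) 2 discMeasure) atTop (𝓝 0) := by
    have hsum := ENNReal.Tendsto.const_mul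
      (tendsto_finsetSum Finset.univ fun j _ => hpartial i j) (Or.inr hC)
    simp only [Finset.sum_const_zero, mul_zero] at hsum
    exact tendsto_of_tendsto_of_tendsto_of_le_of_le tendsto_const_nhds hsum (fun _ => zero_le)
      fun n => hpoincare _ ((hψ n).apply i)
  have hcoord (i : Fin 2) : (fun x => u x i) =ᵐ[discMeasure] 0 :=
    tendstoInMeasure_ae_unique
      (tendstoInMeasure_of_tendsto_eLpNorm two_ne_zero
        (fun n => ((hψ n).apply i).contDiff.continuous.aestronglyMeasurable)
        (memLp_apply hu.1.1 i).1 (hψu i))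
      (tendstoInMeasure_of_tendsto_eLpNorm two_ne_zero
        (fun n => ((hψ n).apply i).contDiff.continuous.aestronglyMeasurable)
        aestronglyMeasurable_zero (by simpa only [sub_zero] using hzero i))
  filter_upwards [hcoord 0, hcoord 1] with x h0 h1
  ext i
  fin_cases i
  exacts [h0, h1]

end Poincare

section Integrand

variable {x : Plane} {ε : ℝ} {H : Plane → Matrix (Fin 2) (Fin 2) ℝ}

theorem norm_radial (hx : x ≠ 0) : ‖radial x‖ = 1 :=
  norm_smul_inv_norm hx

theorem radial_sq_add_sq (hx : x ≠ 0) : radial x 0 ^ 2 + radial x 1 ^ 2 = 1 := by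
  rw [← Fin.sum_univ_two fun i => radial x i ^ 2, ← EuclideanSpace.real_norm_sq_eq,
    norm_radial hx, one_pow]

theorem integrand_eq (ε : ℝ) (x : Plane) (ξ : Matrix (Fin 2) (Fin 2) ℝ) :
    integrand ε x ξ =
      ε⁻¹ * ((radial x 0 * ξ 0 0 + radial x 1 * ξ 1 0) ^ 2 +
        (radial x 0 * ξ 0 1 + radial x 1 * ξ 1 1) ^ 2) +
      ε * ((radial x 0 * ξ 1 1 - radial x 1 * ξ 0 1) ^ 2 +
        (radial x 1 * ξ 0 0 - radial x 0 * ξ 1 0) ^ 2) := by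
  simp only [integrand, EuclideanSpace.real_norm_sq_eq, Fin.sum_univ_two, Matrix.toLpLin_apply,
    Matrix.mulVec, dotProduct, Matrix.adjugate_fin_two, Matrix.transpose_apply, Matrix.of_apply,
    Matrix.cons_val_zero, Matrix.cons_val_one]
  ring

theorem integrand_one_eq_frobeniusSq (hx : x ≠ 0) (ξ : Matrix (Fin 2) (Fin 2) ℝ) :
    integrand 1 x ξ = frobeniusSq ξ := by
  simp only [integrand_eq, frobeniusSq, Fin.sum_univ_two]
  linear_combination (ξ 0 0 ^ 2 + ξ 0 1 ^ 2 + ξ 1 0 ^ 2 + ξ 1 1 ^ 2) * radial_sq_add_sq hx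

theorem min_mul_frobeniusSq_le_integrand (hx : x ≠ 0) (ε : ℝ) (ξ : Matrix (Fin 2) (Fin 2) ℝ) :
    min ε ε⁻¹ * frobeniusSq ξ ≤ integrand ε x ξ := by
  rw [← integrand_one_eq_frobeniusSq hx, integrand, inv_one, one_mul, one_mul, mul_add]
  exact add_le_add (mul_le_mul_of_nonneg_right (min_le_right _ _) (sq_nonneg _))
    (mul_le_mul_of_nonneg_right (min_le_left _ _) (sq_nonneg _))

theorem integrand_one_add (hx : x ≠ 0) (ε : ℝ) (ξ : Matrix (Fin 2) (Fin 2) ℝ) :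
    integrand ε x (1 + ξ) = integrand ε x 1 + integrand ε x ξ + 2 * ε * ξ.trace -
      2 * (ε - ε⁻¹) * radialForm 0 x ξ := by
  simp only [integrand_eq, radialForm, radialTensor_zero_apply, Fin.sum_univ_two,
    Matrix.trace_fin_two, Matrix.add_apply, Matrix.one_apply_eq,
    Matrix.one_apply_ne (zero_ne_one (α := Fin 2)), Matrix.one_apply_ne (one_ne_zero (α := Fin 2))]
  linear_combination 2 * ε * (ξ 0 0 + ξ 1 1) * radial_sq_add_sq hx

theorem norm_radial_apply_le_one (x : Plane) (i : Fin 2) : ‖radial x i‖ ≤ 1 := by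
  refine (PiLp.norm_apply_le _ i).trans ?_
  rw [radial, norm_smul, norm_inv, norm_norm]
  exact inv_mul_le_one

theorem measurable_radial_apply (i : Fin 2) : Measurable fun x => radial x i :=
  measurable_norm.inv.mul (EuclideanSpace.proj i : Plane →L[ℝ] ℝ).measurable

theorem memLp_radial_mul {F : Plane → ℝ} {p : ℝ≥0∞} {μ : Measure Plane} (hF : MemLp F p μ)
    (i : Fin 2) : MemLp (fun x => radial x i * F x) p μ :=
  hF.of_le ((measurable_radial_apply i).aestronglyMeasurable.mul hF.1)
    (ae_of_all _ fun x => by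
      rw [norm_mul]
      exact mul_le_of_le_one_left (norm_nonneg _) (norm_radial_apply_le_one x i))

theorem integrable_integrand {μ : Measure Plane} (hH : ∀ i j, MemLp (fun x => H x i j) 2 μ)
    (ε : ℝ) : Integrable (fun x => integrand ε x (H x)) μ := by
  have hmul (k i j : Fin 2) := memLp_radial_mul (hH i j) k
  simp only [integrand_eq]
  exact ((((hmul 0 0 0).add (hmul 1 1 0)).integrable_sq.add
      ((hmul 0 0 1).add (hmul 1 1 1)).integrable_sq).const_mul _).add
    ((((hmul 0 1 1).sub (hmul 1 0 1)).integrable_sq.add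
      ((hmul 1 0 0).sub (hmul 0 1 0)).integrable_sq).const_mul _)

end Integrand

section WeakGradient

variable {v w : Plane → Plane} {G K : Plane → Matrix (Fin 2) (Fin 2) ℝ}

theorem HasWeakGradient.weakGradient_ae_eq (hG : HasWeakGradient v G)
    (hv : MemLp v 2 discMeasure) : weakGradient v =ᵐ[discMeasure] G :=
  (show MemW12 v from ⟨hv, G, hG⟩).hasWeakGradient.ae_eq hG

theorem HasWeakGradient.sub (hG : HasWeakGradient v G) (hK : HasWeakGradient w K)
    (hv : MemLp v 2 discMeasure) (hw : MemLp w 2 discMeasure) :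
    HasWeakGradient (v - w) (G - K) where
  memLp i j := (hG.memLp i j).sub (hK.memLp i j)
  integral_eq i j φ hφ := by
    have hint {F g : Plane → ℝ} (hF : MemLp F 2 discMeasure) (hg : IsTestFunction g) :
        Integrable (fun x => F x * g x) discMeasure :=
      hF.integrable_mul ((hg.memLp 2).restrict _)
    simp only [Pi.sub_apply, PiLp.sub_apply, Matrix.sub_apply, sub_mul]
    rw [integral_sub (hint (memLp_apply hv i) (hφ.partialDeriv j))
        (hint (memLp_apply hw i) (hφ.partialDeriv j)),
      integral_sub (hint (hG.memLp i j) hφ) (hint (hK.memLp i j) hφ),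
      hG.integral_eq i j φ hφ, hK.integral_eq i j φ hφ, neg_sub_neg, neg_sub]

theorem hasWeakGradient_zero : HasWeakGradient 0 0 where
  memLp _ _ := MemLp.zero
  integral_eq _ _ _ _ := by simp

theorem memW120_zero : MemW120 0 := by
  refine ⟨⟨MemLp.zero, 0, hasWeakGradient_zero⟩, 0,
    fun _ => ⟨contDiff_const, HasCompactSupport.zero, by simp⟩, by simp, fun i j => ?_⟩
  refine tendsto_const_nhds.congr fun n => ?_
  rw [eq_comm, ← eLpNorm_zero (α := Plane) (ε := ℝ) (p := 2) (μ := discMeasure)]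
  refine eLpNorm_congr_ae ?_
  filter_upwards [hasWeakGradient_zero.weakGradient_ae_eq MemLp.zero] with x hx
  simp [hx, partialDeriv]

theorem memLp_id : MemLp (id : Plane → Plane) 2 discMeasure :=
  memLp_discMeasure_of_continuous continuous_id 2

theorem hasWeakGradient_id : HasWeakGradient id 1 where
  memLp _ _ := memLp_const _
  integral_eq i j φ hφ := by
    simp only [id]
    rw [hφ.integral_mul_partialDeriv (contDiff_piLp_apply 2)]
    simp only [partialDeriv_coord, Pi.one_apply, Matrix.one_apply]

theorem weakGradient_id : weakGradient id =ᵐ[discMeasure] 1 :=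
  hasWeakGradient_id.weakGradient_ae_eq memLp_id

theorem memW12_id : MemW12 id := ⟨memLp_id, 1, hasWeakGradient_id⟩

theorem id_mem_admissible : id ∈ admissible := by
  refine ⟨⟨memW12_id, ?_⟩, memW12_id, by simpa only [sub_self] using memW120_zero⟩
  filter_upwards [weakGradient_id] with x hx
  rw [hx, Pi.one_apply, Matrix.det_one]

theorem MemW12.weakGradient_ae_eq_one_add (hv : MemW12 v) (hu : MemW12 (v - id)) :
    weakGradient v =ᵐ[discMeasure] fun x => 1 + weakGradient (v - id) x := by
  filter_upwards [hu.hasWeakGradient.ae_eq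
    (hv.hasWeakGradient.sub hasWeakGradient_id hv.1 memLp_id)] with x hx
  rw [hx, Pi.sub_apply, Pi.one_apply, add_sub_cancel]

end WeakGradient

section Energy

variable {ε : ℝ} {v : Plane → Plane} {H : Plane → Matrix (Fin 2) (Fin 2) ℝ}

theorem trace_eq_neg_det_of_det_one_add {R : Type*} [CommRing R] {ξ : Matrix (Fin 2) (Fin 2) R}
    (h : (1 + ξ).det = 1) : ξ.trace = -ξ.det := by
  simp only [Matrix.det_fin_two, Matrix.add_apply, Matrix.one_apply_eq,
    Matrix.one_apply_ne (zero_ne_one (α := Fin 2)), Matrix.one_apply_ne (one_ne_zero (α := Fin 2)),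
    zero_add] at h
  rw [Matrix.trace_fin_two, Matrix.det_fin_two]
  linear_combination h

theorem integrable_trace {α n : Type*} [Fintype n] [MeasurableSpace α] {μ : Measure α}
    {B : α → Matrix n n ℝ} (hB : ∀ i, Integrable (fun x => B x i i) μ) :
    Integrable (fun x => (B x).trace) μ :=
  integrable_finsetSum _ fun i _ => hB i

theorem integral_trace {α n : Type*} [Fintype n] [MeasurableSpace α] {μ : Measure α}
    {B : α → Matrix n n ℝ} (hB : ∀ i, Integrable (fun x => B x i i) μ) :
    ∫ x, (B x).trace ∂μ = ∑ i, ∫ x, B x i i ∂μ :=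
  integral_finsetSum _ fun i _ => hB i

theorem MemW120.integral_trace_weakGradient {u : Plane → Plane} (hu : MemW120 u) :
    ∫ x in disc, (weakGradient u x).trace = 0 := by
  rw [integral_trace fun i => (hu.memLp_weakGradient i i).integrable one_le_two]
  exact Finset.sum_eq_zero fun i _ => hu.integral_weakGradient i i

theorem energy_id (ε : ℝ) : energy ε id = ∫ x in disc, integrand ε x 1 := by
  refine integral_congr_ae ?_
  filter_upwards [weakGradient_id] with x hx
  rw [hx, Pi.one_apply]

theorem integral_integrand_one_add (hH : ∀ i j, MemLp (fun x => H x i j) 2 discMeasure)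
    (ε : ℝ) : ∫ x in disc, integrand ε x (1 + H x) =
      (∫ x in disc, integrand ε x 1) + (∫ x in disc, integrand ε x (H x)) +
        2 * ε * (∫ x in disc, (H x).trace) -
        2 * (ε - ε⁻¹) * ∫ x in disc, radialForm 0 x (H x) := by
  have hone : Integrable (fun x => integrand ε x 1) discMeasure :=
    integrable_integrand (H := fun _ => 1) (fun _ _ => memLp_const _) ε
  have hquad := integrable_integrand hH ε
  have htrace := (integrable_trace fun i => (hH i i).integrable one_le_two).const_mul (2 * ε)
  have hform := (integrable_radialForm hH 0).const_mul (2 * (ε - ε⁻¹))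
  rw [← integral_const_mul, ← integral_const_mul, ← integral_add hone hquad,
    ← integral_add (hone.fun_add hquad) htrace,
    ← integral_sub ((hone.fun_add hquad).fun_add htrace) hform]
  refine integral_congr_ae ?_
  filter_upwards [ae_discMeasure_ne_zero] with x hx
  exact integrand_one_add hx ε (H x)

theorem energy_eq_energy_id_add (hv : v ∈ identityBoundary) (ε : ℝ) :
    energy ε v = energy ε id + (∫ x in disc, integrand ε x (weakGradient (v - id) x)) -
      2 * (ε - ε⁻¹) * ∫ x in disc, radialForm 0 x (weakGradient (v - id) x) :=
  calc energy ε v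
    _ = ∫ x in disc, integrand ε x (1 + weakGradient (v - id) x) := by
      refine integral_congr_ae ?_
      filter_upwards [hv.1.weakGradient_ae_eq_one_add hv.2.1] with x hx
      rw [hx]
    _ = _ := by
      rw [integral_integrand_one_add hv.2.memLp_weakGradient, hv.2.integral_trace_weakGradient,
        mul_zero, add_zero, energy_id]

theorem min_mul_integral_frobeniusSq_le
    (hH : ∀ i j, MemLp (fun x => H x i j) 2 discMeasure) (ε : ℝ) :
    min ε ε⁻¹ * ∫ x in disc, frobeniusSq (H x) ≤ ∫ x in disc, integrand ε x (H x) := by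
  rw [← integral_const_mul]
  refine integral_mono_ae ((integrable_frobeniusSq hH).const_mul _) (integrable_integrand hH ε) ?_
  filter_upwards [ae_discMeasure_ne_zero] with x hx
  exact min_mul_frobeniusSq_le_integrand hx ε (H x)

theorem energy_id_add_le (hv : v ∈ admissible) (ε : ℝ) :
    energy ε id + (min ε ε⁻¹ - |ε - ε⁻¹|) *
      ∫ x in disc, frobeniusSq (weakGradient (v - id) x) ≤ energy ε v := by
  have htr : ∀ᵐ x ∂discMeasure,
      (weakGradient (v - id) x).trace = -(weakGradient (v - id) x).det := by
    filter_upwards [hv.1.2, hv.1.1.weakGradient_ae_eq_one_add hv.2.2.1] with x hdet hx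
    exact trace_eq_neg_det_of_det_one_add (hx ▸ hdet)
  have hform := hv.2.2.abs_integral_radialForm_le htr
  have hquad := min_mul_integral_frobeniusSq_le hv.2.2.memLp_weakGradient ε
  have hcross : 2 * (ε - ε⁻¹) * ∫ x in disc, radialForm 0 x (weakGradient (v - id) x) ≤
      |ε - ε⁻¹| * ∫ x in disc, frobeniusSq (weakGradient (v - id) x) := by
    refine (le_abs_self _).trans ?_
    rw [abs_mul, abs_mul, abs_two]
    linarith [mul_le_mul_of_nonneg_left hform (abs_nonneg (ε - ε⁻¹))]
  rw [energy_eq_energy_id_add hv.2 ε]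
  linarith

theorem min_sub_abs_sub (a b : ℝ) : min a b - |a - b| = min (2 * a - b) (2 * b - a) := by
  rcases le_total a b with h | h
  · rw [min_eq_left h, abs_of_nonpos (sub_nonpos.2 h), min_eq_left (by linarith)]
    ring
  · rw [min_eq_right h, abs_of_nonneg (sub_nonneg.2 h), min_eq_right (by linarith)]
    ring

theorem le_two_mul_inv_iff {a : ℝ} (ha : 0 < a) : a ≤ 2 * a⁻¹ ↔ a ≤ √2 := by
  rw [← div_eq_mul_inv, le_div_iff₀ ha, ← sq, Real.le_sqrt' ha]

theorem lt_two_mul_inv_iff {a : ℝ} (ha : 0 < a) : a < 2 * a⁻¹ ↔ a < √2 := by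
  rw [← div_eq_mul_inv, lt_div_iff₀ ha, ← sq, Real.lt_sqrt ha.le]

theorem abs_sub_inv_le_min (hε : (√2)⁻¹ ≤ ε) (hε' : ε ≤ √2) : |ε - ε⁻¹| ≤ min ε ε⁻¹ := by
  have hpos : 0 < ε := (inv_pos.2 (Real.sqrt_pos.2 two_pos)).trans_le hε
  have hinv := (le_two_mul_inv_iff (inv_pos.2 hpos)).2
    (inv_le_of_inv_le₀ (Real.sqrt_pos.2 two_pos) hε)
  rw [inv_inv] at hinv
  rw [← sub_nonneg, min_sub_abs_sub]
  exact le_min (sub_nonneg.2 hinv) (sub_nonneg.2 ((le_two_mul_inv_iff hpos).2 hε'))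

theorem abs_sub_inv_lt_min (hε : (√2)⁻¹ < ε) (hε' : ε < √2) : |ε - ε⁻¹| < min ε ε⁻¹ := by
  have hpos : 0 < ε := (inv_pos.2 (Real.sqrt_pos.2 two_pos)).trans hε
  have hinv := (lt_two_mul_inv_iff (inv_pos.2 hpos)).2
    (inv_lt_of_inv_lt₀ (Real.sqrt_pos.2 two_pos) hε)
  rw [inv_inv] at hinv
  rw [← sub_pos, min_sub_abs_sub]
  exact lt_min (sub_pos.2 hinv) (sub_pos.2 ((lt_two_mul_inv_iff hpos).2 hε'))

theorem isGlobalMinimizer_id (hε : |ε - ε⁻¹| ≤ min ε ε⁻¹) : IsGlobalMinimizer ε id :=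
  ⟨id_mem_admissible, fun _ hv => (le_add_of_nonneg_right (mul_nonneg (sub_nonneg.2 hε)
    (integral_nonneg fun _ => frobeniusSq_nonneg _))).trans (energy_id_add_le hv ε)⟩

theorem IsGlobalMinimizer.ae_eq_id (hv : IsGlobalMinimizer ε v) (hε : |ε - ε⁻¹| < min ε ε⁻¹) :
    v =ᵐ[discMeasure] id := by
  have hu : MemW120 (v - id) := hv.1.2.2
  have hnonneg (x : Plane) := frobeniusSq_nonneg (weakGradient (v - id) x)
  have hle : (min ε ε⁻¹ - |ε - ε⁻¹|) *
      ∫ x in disc, frobeniusSq (weakGradient (v - id) x) ≤ 0 := by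
    linarith [energy_id_add_le hv.1 ε, hv.2 id id_mem_admissible]
  have hzero : ∫ x in disc, frobeniusSq (weakGradient (v - id) x) = 0 :=
    (nonpos_of_mul_nonpos_right hle (sub_pos.2 hε)).antisymm (integral_nonneg hnonneg)
  have hgrad : weakGradient (v - id) =ᵐ[discMeasure] 0 := by
    filter_upwards [(integral_eq_zero_iff_of_nonneg hnonneg
      (integrable_frobeniusSq hu.memLp_weakGradient)).1 hzero] with x hx
    exact eq_zero_of_frobeniusSq_eq_zero hx
  filter_upwards [hu.ae_eq_zero hgrad] with x hx
  exact sub_eq_zero.1 hx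

end Energy

end Buckling

theorem mainTheorem8_general :
    (∀ ε : ℝ, (√2)⁻¹ ≤ ε → ε ≤ √2 → Buckling.IsGlobalMinimizer ε id) ∧
      ∀ ε : ℝ, (√2)⁻¹ < ε → ε < √2 → ∀ v : Buckling.Plane → Buckling.Plane,
        Buckling.IsGlobalMinimizer ε v → v =ᵐ[Buckling.discMeasure] id :=
  ⟨fun _ h1 h2 => Buckling.isGlobalMinimizer_id (Buckling.abs_sub_inv_le_min h1 h2),
    fun _ h1 h2 _ hv => hv.ae_eq_id (Buckling.abs_sub_inv_lt_min h1 h2)⟩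

theorem mainTheorem8 :
    (∀ ε : ℝ, 1 < ε → ε < √2 →
      Buckling.IsGlobalMinimizer ε id ∧
        ∀ v : Buckling.Plane → Buckling.Plane, Buckling.IsGlobalMinimizer ε v →
          v =ᵐ[Buckling.discMeasure] id) ∧
      Buckling.IsGlobalMinimizer √2 id := by
  have h : (√2)⁻¹ < 1 := inv_lt_one_of_one_lt₀ Real.one_lt_sqrt_two
  exact ⟨fun ε h1 h2 => ⟨mainTheorem8_general.1 ε (h.trans h1).le h2.le,
    mainTheorem8_general.2 ε (h.trans h1) h2⟩,
    mainTheorem8_general.1 √2 (h.trans Real.one_lt_sqrt_two).le le_rfl⟩
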